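/- Let $\xi$ be Riemann's $\xi$-function, the entire function that continues $\xi(s)=\tfrac12 s(s-1)\pi^{-s/2}\Gamma(s/2)\zeta(s)$. The Riemann Hypothesis (RH) says that all non-trivial zeros of $\zeta$ have real part $\tfrac12$. Products and sums over $\tau>0$ run over the positive ordinates of the zeros $\tfrac12+i\tau$ of $\xi$ on the critical line, each repeated according to the multiplicity of the zero. A Thorin measure is a non-negative measure $U$ on $(0,\infty)$, finite on compact subsets of $(0,\infty)$, with $\int_{(0,1)}|\log z|\,U(dz)<\infty$ and $\int_{(1,\infty)}z^{-1}\,U(dz)<\infty$. A probability distribution on $[0,\infty)$ is a generalized gamma convolution (GGC) with left-extremity $a\ge 0$ and Thorin measure $U$ if a random variable $H$ with this distribution satisfies, for all $s>0$, $$E(e^{-sH})=\exp\Big(-as+\int_{(0,\infty)}\log\frac{z}{z+s}\,U(dz)\Big).$$ Thorin's condition for $\xi(\tfrac12)/\xi(\tfrac12+\sqrt s)$ says that there is a random variable $H$ with a GGC distribution (for some $a$ and $U$) such that $\xi(\tfrac12)/\xi(\tfrac12+\sqrt s)=E(e^{-sH})$ for all $s>0$. 1. Assume RH. Then $\sum_{\tau>0}\tau^{-2}<\infty$,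 and for every $s\in\mathbb C$ with $\xi(\tfrac12+s)\ne0$, $$\frac{\xi(\frac12)}{\xi(\frac12+s)}=\prod_{\tau>0}\frac{\tau^2}{\tau^2+s^2},$$ where the product converges unconditionally. There exist independent random variables $Y_\tau\sim\mathrm{Exp}(\tau^2)$ (rate $\tau^2$), $\tau>0$, on a common probability space. For every such family, on any probability space, the sum $H=\sum_{\tau>0}Y_\tau$ converges almost surely, $H$ has a GGC distribution with left-extremity $0$ and Thorin measure $\sum_{\tau>0}\delta_{\tau^2}$, and $$\frac{\xi(\frac12)}{\xi(\frac12+s)}=E\big(\exp(-s^2H)\big)$$ for every $s\in\mathbb C$ with $\operatorname{Re}(s^2)\ge0$, in particular for every real $s$. 2. Conversely, if Thorin's condition holds for $\xi(\tfrac12)/\xi(\tfrac12+\sqrt s)$, then every zero $\rho$ of $\xi$ satisfies $\operatorname{Re}\rho=\tfrac12$. 3. Consequently, RH holds if and only if Thorin's condition holds for $\xi(\tfrac12)/\xi(\tfrac12+\sqrt s)$. -/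

import Mathlib

open MeasureTheory ProbabilityTheory Set

/-- Riemann's `ξ`-function, as an entire function. Here `completedRiemannZeta₀ s` is the entire
function `π ^ (-s/2) Γ(s/2) ζ(s) + 1 / s + 1 / (1 - s)`, so that this is the analytic continuation
of `(1/2) s (s - 1) π ^ (-s/2) Γ(s/2) ζ(s)`; see `riemannXi_eq` and `differentiable_riemannXi`. -/
noncomputable def riemannXi (s : ℂ) : ℂ :=
  (s * (s - 1) * completedRiemannZeta₀ s + 1) / 2

/-- `ξ(s) = (1/2) s (s - 1) π ^ (-s/2) Γ(s/2) ζ(s)` wherever `Γ(s/2)` and `ζ(s)` have no pole. -/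
theorem riemannXi_eq {s : ℂ} (h1 : s ≠ 1) (hG : ∀ n : ℕ, s ≠ -(2 * n)) :
    riemannXi s = 1 / 2 * s * (s - 1) * (Real.pi : ℂ) ^ (-s / 2) * Complex.Gamma (s / 2) *
      riemannZeta s := by
  have h0 : s ≠ 0 := by simpa using hG 0
  have h1' : (1 : ℂ) - s ≠ 0 := sub_ne_zero.mpr (Ne.symm h1)
  have hΓ : Complex.Gamma (s / 2) ≠ 0 := by
    refine Complex.Gamma_ne_zero fun m hm => hG m ?_
    linear_combination 2 * hm
  have hπ : (Real.pi : ℂ) ^ (-s / 2) ≠ 0 := by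
    simp [Complex.cpow_eq_zero_iff, Real.pi_ne_zero]
  rw [riemannZeta_eq_completedRiemannZeta₀ h0, riemannXi]
  field_simp
  ring

theorem differentiable_riemannXi : Differentiable ℂ riemannXi := by
  have h := differentiable_completedZeta₀
  unfold riemannXi
  fun_prop

/-- The positive ordinates `τ > 0` of the zeros `1/2 + iτ` of `ξ` on the critical line, each one
repeated according to the multiplicity of the zero. -/
abbrev XiOrdinate : Type :=
  Σ τ : {τ : ℝ // 0 < τ ∧ riemannXi (1 / 2 + Complex.I * τ) = 0},
    Fin (analyticOrderNatAt riemannXi (1 / 2 + Complex.I * (τ : ℝ)))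

/-- The ordinate `τ` itself. -/
def XiOrdinate.val (i : XiOrdinate) : ℝ := i.1.1

/-- `U` is a Thorin measure: a measure carried by `(0, ∞)`, finite on the compact subsets of
`(0, ∞)`, with `∫_{(0,1)} |log z| U(dz) < ∞` and `∫_{(1,∞)} z⁻¹ U(dz) < ∞`. -/
structure IsThorinMeasure (U : Measure ℝ) : Prop where
  carried : U (Iic 0) = 0
  finite_compact : ∀ K : Set ℝ, IsCompact K → K ⊆ Ioi 0 → U K < ⊤
  integrable_log : IntegrableOn Real.log (Ioo 0 1) U
  integrable_inv : IntegrableOn (fun z : ℝ => z⁻¹) (Ioi 1) U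

/-- `μ` is the generalized gamma convolution on `[0, ∞)` with left-extremity `a` and Thorin
measure `U`. -/
structure IsGGCWith (μ : Measure ℝ) (a : ℝ) (U : Measure ℝ) : Prop where
  prob : IsProbabilityMeasure μ
  carried : μ (Iio 0) = 0
  left_nonneg : 0 ≤ a
  thorin : IsThorinMeasure U
  laplace : ∀ s : ℝ, 0 < s →
    ∫ x, Real.exp (-s * x) ∂μ = Real.exp (-a * s + ∫ z in Ioi 0, Real.log (z / (z + s)) ∂U)

/-- `μ` is a generalized gamma convolution (GGC). -/
def IsGGC (μ : Measure ℝ) : Prop := ∃ (a : ℝ) (U : Measure ℝ), IsGGCWith μ a U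

/-- Thorin's condition for the reciprocal `ξ`-function: there is a GGC distribution `μ`
(the law of `H`) with `ξ(1/2) / ξ(1/2 + √s) = E exp(-s H)` for all `s > 0`. -/
def XiThorinCondition : Prop :=
  ∃ μ : Measure ℝ, IsGGC μ ∧ ∀ s : ℝ, 0 < s →
    riemannXi (1 / 2) / riemannXi (1 / 2 + (√s : ℝ)) = ((∫ x, Real.exp (-s * x) ∂μ : ℝ) : ℂ)

/-- `(Y_τ)` are independent random variables on the probability space `(Ω, P)`, with
`Y_τ ∼ Exp(τ²)` (rate `τ²`), one for each positive ordinate `τ` counted with multiplicity. -/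
structure IsXiExpFamily {Ω : Type*} [MeasurableSpace Ω] (P : Measure Ω)
    (Y : XiOrdinate → Ω → ℝ) : Prop where
  prob : IsProbabilityMeasure P
  law : ∀ i : XiOrdinate, HasLaw (Y i) (expMeasure (i.val ^ 2)) P
  indep : iIndepFun Y P

/-- The Thorin measure `∑_{τ > 0} δ_{τ²}`. -/
noncomputable def xiThorinMeasure : Measure ℝ :=
  Measure.sum fun i : XiOrdinate => Measure.dirac (i.val ^ 2)

/-! Under RH everything rests on the product `ξ(1/2 + s) = ξ(1/2) ∏ (1 + s²/τ²)`, which needs only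
two features of `ξ`: evenness about `1/2` and growth of order less than `2`. The completed zeta
function is a Mellin transform of a nonnegative kernel, so it is controlled by its values on the
real axis, and there a crude Gamma bound gives `|ξ(1/2 + s)| ≤ C exp(4(|s| + 3)^(3/2))`
(`exists_norm_riemannXi_le`). Dividing out the zeros up to height `R` leaves an even function,
zero-free on `|z| ≤ R`, whose logarithm has real part `O(R^(3/2))` on `|z| < R`. Evenness kills the
linear term, so Borel–Carathéodory and the Schwarz lemma bound this logarithm at a fixed `s` by
`O(R^(3/2) / R²)`, which tends to `0` (`tendsto_xiProd`). At `s = 1` this gives `∑ τ⁻² < ∞`, hence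
unconditional convergence. Each factor `τ²/(τ² + w)` is the Laplace transform of `Exp(τ²)`, so
independence and dominated convergence turn the reciprocal product into `E exp(-wH)` with `w = s²`;
logarithms of the factors give the Thorin representation. Conversely, a GGC Laplace transform
extends to the slit plane as the exponential of a holomorphic function. Squaring sends `Re s > 0`
into the slit plane, so the identity theorem forbids zeros of `ξ(1/2 + s)` there, and `s ↦ -s`
excludes the other half-plane. -/

/-! ### Positivity of the Mellin kernel of the completed zeta function -/

-- The theta series is at least its term `n = 0`, which is `1`; its functional equation turns this
-- into `θ(t) ≥ t^(-1/2)`. These are the functions subtracted on `(1, ∞)` and `(0, 1)`.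
open HurwitzZeta in
theorem exists_nonneg_eq_f_modif : ∃ k : ℝ → ℝ, (∀ t, 0 < t → 0 ≤ k t) ∧
    ∀ t, 0 < t → (hurwitzEvenFEPair 0).f_modif t = (k t : ℂ) := by
  have one_le : ∀ t : ℝ, 0 < t → 1 ≤ evenKernel 0 t := by
    intro t ht
    have h := hasSum_int_evenKernel 0 ht
    have h2 := h.summable.le_tsum 0 (fun j _ => (Real.exp_pos _).le)
    have h3 : evenKernel ((0 : ℝ) : UnitAddCircle) t = evenKernel 0 t := by norm_num
    rw [h.tsum_eq, h3] at h2
    simpa using h2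
  have rpow_le : ∀ t : ℝ, 0 < t → t ^ (-(1 / 2) : ℝ) ≤ evenKernel 0 t := by
    intro t ht
    rw [evenKernel_functional_equation, ← evenKernel_eq_cosKernel_of_zero, Real.rpow_neg ht.le]
    have := one_le (1 / t) (by positivity)
    have h0 : 0 ≤ 1 / t ^ (1 / 2 : ℝ) := by positivity
    calc (t ^ (1 / 2 : ℝ))⁻¹ = 1 / t ^ (1 / 2 : ℝ) * 1 := by simp
      _ ≤ _ := by gcongr
  refine ⟨(Ioi 1).indicator (fun x => evenKernel 0 x - 1) +
    (Ioo 0 1).indicator (fun x => evenKernel 0 x - x ^ (-(1 / 2) : ℝ)), ?_, ?_⟩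
  · intro t ht
    refine add_nonneg (indicator_nonneg ?_ t) (indicator_nonneg ?_ t)
    · intro x hx
      have := one_le x (lt_trans one_pos hx)
      simpa using this
    · intro x hx
      have := rpow_le x hx.1
      linarith
  · intro t ht
    simp only [WeakFEPair.f_modif, hurwitzEvenFEPair, Pi.add_apply, indicator]
    split_ifs <;> simp

theorem completedRiemannZeta₀_eq_mellin (s : ℂ) :
    completedRiemannZeta₀ s = mellin (HurwitzZeta.hurwitzEvenFEPair 0).f_modif (s / 2) / 2 := rfl

/-- On the vertical strip `|Re s| ≤ r` around the critical line, the entire completed zeta function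
is bounded by its values on the real axis. -/
theorem norm_completedRiemannZeta₀_le {r : ℝ} {s : ℂ} (hs : |s.re| ≤ r) :
    ‖completedRiemannZeta₀ (1 / 2 + s)‖ ≤ 2 * (completedRiemannZeta₀ (1 / 2 + r)).re := by
  obtain ⟨k, hk0, hk⟩ := exists_nonneg_eq_f_modif
  set f := (HurwitzZeta.hurwitzEvenFEPair 0).f_modif with hf
  have conv : ∀ z : ℂ, MellinConvergent f z := fun z =>
    ((HurwitzZeta.hurwitzEvenFEPair 0).isStrongFEPair_toStrongFEPair.hasMellin z).1
  have real : ∀ x : ℝ, IntegrableOn (fun t : ℝ => t ^ (x - 1) * k t) (Ioi 0) ∧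
      (mellin f x).re = ∫ t in Ioi 0, t ^ (x - 1) * k t := by
    intro x
    have e : ∀ t ∈ Ioi (0 : ℝ), (t : ℂ) ^ ((x : ℂ) - 1) • f t = ((t ^ (x - 1) * k t : ℝ) : ℂ) := by
      intro t ht
      rw [hk t ht, smul_eq_mul]
      push_cast
      rw [Complex.ofReal_cpow (le_of_lt ht)]
      push_cast
      rfl
    have h1 := (integrableOn_congr_fun e measurableSet_Ioi).1 (conv x)
    refine ⟨by simpa [IntegrableOn] using h1.re, ?_⟩
    rw [mellin, setIntegral_congr_fun measurableSet_Ioi e, integral_complex_ofReal, Complex.ofReal_re]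
  -- A power `t^(Re z - 1)` is at most the sum of the powers at the two edges of the strip. The
  -- functional equation makes the two edge integrals equal, whence the factor `2`.
  have main : ∀ z : ℂ, |(z.re - 1 / 4)| ≤ r / 2 →
      ‖mellin f z‖ ≤ (mellin f ((1 / 4 + r / 2 : ℝ) : ℂ)).re +
        (mellin f ((1 / 4 - r / 2 : ℝ) : ℂ)).re := by
    intro z hz
    rw [(real _).2, (real _).2, ← integral_add (real _).1 (real _).1, mellin]
    refine (norm_integral_le_integral_norm _).trans ?_
    refine setIntegral_mono_on (conv z).norm ((real _).1.add (real _).1) measurableSet_Ioi ?_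
    intro t ht
    rw [norm_smul, Complex.norm_cpow_eq_rpow_re_of_pos ht, hk t ht, Complex.norm_real,
      Real.norm_of_nonneg (hk0 t ht), ← add_mul]
    refine mul_le_mul_of_nonneg_right ?_ (hk0 t ht)
    have ht' : (0 : ℝ) < t := ht
    obtain ⟨h1, h2⟩ := abs_le.1 hz
    simp only [Complex.sub_re, Complex.one_re]
    have p1 : 0 < t ^ (1 / 4 + r / 2 - 1) := Real.rpow_pos_of_pos ht' _
    have p2 : 0 < t ^ (1 / 4 - r / 2 - 1) := Real.rpow_pos_of_pos ht' _
    rcases le_total 1 t with h | h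
    · have := Real.rpow_le_rpow_of_exponent_le h (show z.re - 1 ≤ 1 / 4 + r / 2 - 1 by linarith)
      linarith
    · have := Real.rpow_le_rpow_of_exponent_ge ht' h
        (show 1 / 4 - r / 2 - 1 ≤ z.re - 1 by linarith)
      linarith
  have hz := main ((1 / 2 + s) / 2) (by
    have : ((1 / 2 + s) / 2 : ℂ).re - 1 / 4 = s.re / 2 := by
      rw [show ((1 / 2 + s) / 2 : ℂ) = ((1 / 4 : ℝ) : ℂ) + ((1 / 2 : ℝ) : ℂ) * s by push_cast; ring]
      simp
      ring
    rw [this, abs_div, abs_two]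
    linarith)
  have e1 : completedRiemannZeta₀ (1 / 2 + r) = mellin f ((1 / 4 + r / 2 : ℝ) : ℂ) / 2 := by
    rw [completedRiemannZeta₀_eq_mellin]; congr 2; push_cast; ring
  have e2 : completedRiemannZeta₀ (1 / 2 + r) = mellin f ((1 / 4 - r / 2 : ℝ) : ℂ) / 2 := by
    rw [← completedRiemannZeta₀_one_sub, completedRiemannZeta₀_eq_mellin]
    congr 2; push_cast; ring
  have d : ∀ z : ℂ, (z / 2).re = z.re / 2 := fun z => by simp
  have e1' := congrArg Complex.re e1
  have e2' := congrArg Complex.re e2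
  rw [d] at e1' e2'
  rw [completedRiemannZeta₀_eq_mellin, norm_div, Complex.norm_ofNat]
  linarith

/-! ### Symmetry of `ξ` and reformulation of RH -/

theorem riemannXi_one_sub (s : ℂ) : riemannXi (1 - s) = riemannXi s := by
  rw [riemannXi, riemannXi, completedRiemannZeta₀_one_sub]
  ring

theorem riemannXi_half_sub (s : ℂ) : riemannXi (1 / 2 - s) = riemannXi (1 / 2 + s) := by
  rw [← riemannXi_one_sub]
  congr 1
  ring

theorem completedRiemannZeta₀_two : completedRiemannZeta₀ 2 = Real.pi / 6 - 1 / 2 := by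
  have h := riemannZeta_eq_completedRiemannZeta₀ (s := 2) two_ne_zero
  have hπ : (Real.pi : ℂ) ≠ 0 := by simp [Real.pi_ne_zero]
  rw [riemannZeta_two, show (-2 / 2 : ℂ) = -1 by norm_num, show (2 / 2 : ℂ) = 1 by norm_num,
    Complex.Gamma_one, Complex.cpow_neg_one] at h
  field_simp at h
  linear_combination h / 12

/-- A zero at `1/2` would force `completedRiemannZeta₀ (1/2) = 4`, whereas comparison with the value
at `2` bounds it by `2(π/6 - 1/2)`, which is far smaller. -/
theorem riemannXi_half_ne_zero : riemannXi (1 / 2) ≠ 0 := by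
  have h := norm_completedRiemannZeta₀_le (r := 3 / 2) (s := 0) (by norm_num)
  rw [show (1 / 2 + ((3 / 2 : ℝ) : ℂ)) = 2 by push_cast; norm_num, completedRiemannZeta₀_two,
    add_zero] at h
  have h6 : ((Real.pi : ℂ) / 6 - 1 / 2).re = Real.pi / 6 - 1 / 2 := by
    rw [show ((Real.pi : ℂ) / 6 - 1 / 2) = ((Real.pi / 6 - 1 / 2 : ℝ) : ℂ) by push_cast; ring,
      Complex.ofReal_re]
  rw [h6] at h
  intro h0
  have h4 : completedRiemannZeta₀ (1 / 2) = 4 := by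
    rw [riemannXi] at h0
    linear_combination -8 * h0
  rw [h4, Complex.norm_ofNat] at h
  linarith [Real.pi_lt_d2]

theorem riemannXi_ne_zero_of_one_le_re {s : ℂ} (hs : 1 ≤ s.re) : riemannXi s ≠ 0 := by
  rcases eq_or_ne s 1 with rfl | h1
  · norm_num [riemannXi]
  have h0 : s ≠ 0 := by rintro rfl; norm_num at hs
  rw [riemannXi_eq h1 (by
    rintro n rfl
    have : (-(2 * (n : ℂ))).re = -(2 * n : ℝ) := by simp
    rw [this] at hs
    linarith [(Nat.cast_nonneg n : (0 : ℝ) ≤ n)])]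
  have hΓ : Complex.Gamma (s / 2) ≠ 0 :=
    Complex.Gamma_ne_zero_of_re_pos (by simp; linarith)
  have hπ : (Real.pi : ℂ) ^ (-s / 2) ≠ 0 := by
    simp [Complex.cpow_eq_zero_iff, Real.pi_ne_zero]
  have := riemannZeta_ne_zero_of_one_le_re hs
  have := sub_ne_zero.2 h1
  simp_all

theorem riemannHypothesis_iff_riemannXi :
    RiemannHypothesis ↔ ∀ ρ : ℂ, riemannXi ρ = 0 → ρ.re = 1 / 2 := by
  constructor
  · intro h ρ hρ
    have h1 : ρ ≠ 1 := by rintro rfl; norm_num [riemannXi] at hρ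
    -- The reflection of `-2n` has real part at least `1`, where `ξ` does not vanish.
    have hn : ∀ n : ℕ, ρ ≠ -(2 * n) := by
      rintro n rfl
      rw [← riemannXi_one_sub] at hρ
      refine riemannXi_ne_zero_of_one_le_re ?_ hρ
      simp
    have h0 : ρ ≠ 0 := by simpa using hn 0
    have hΓ : Complex.Gamma (ρ / 2) ≠ 0 := by
      refine Complex.Gamma_ne_zero fun m hm => hn m ?_
      linear_combination 2 * hm
    have hπ : (Real.pi : ℂ) ^ (-ρ / 2) ≠ 0 := by
      simp [Complex.cpow_eq_zero_iff, Real.pi_ne_zero]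
    rw [riemannXi_eq h1 hn] at hρ
    refine h ρ ?_ ?_ h1
    · simpa [hΓ, hπ, h0, sub_ne_zero.2 h1] using hρ
    · rintro ⟨n, rfl⟩
      exact hn (n + 1) (by push_cast; ring)
  · intro h s hs hn h1
    refine h s ?_
    rw [riemannXi_eq h1, hs, mul_zero]
    -- The trivial zeros are numbered `-2(n + 1)`, so the pole of `Γ(s/2)` at `s = 0` is excluded
    -- separately by `ζ(0) = -1/2`.
    rintro (_ | n) rfl
    · rw [Nat.cast_zero, mul_zero, neg_zero, riemannZeta_zero] at hs
      norm_num at hs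
    · exact hn ⟨n, by push_cast; ring⟩

/-! ### Growth of `ξ` -/

/-- From `n! ≤ n^n` and `log n ≤ 2 n^(1/2)`. The exponent `3/2` is crude, but any exponent below `2`
serves. -/
theorem Real.Gamma_le_exp_rpow {x T : ℝ} (hx : 1 ≤ x) (hT : x + 1 ≤ T) :
    Real.Gamma x ≤ Real.exp (2 * T ^ (3 / 2 : ℝ)) := by
  have hx0 : 0 < x := by linarith
  have hT0 : 0 < T := by linarith
  set n := ⌈x⌉₊ with hn
  have hnx : x ≤ n := Nat.le_ceil x
  have hnT : (n : ℝ) ≤ T := (Nat.ceil_lt_add_one hx0.le).le.trans hT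
  have hn0 : (0 : ℝ) < n := by linarith
  have h1 : Real.Gamma x ≤ Real.Gamma (x + 1) := by
    rw [Real.Gamma_add_one hx0.ne']
    exact le_mul_of_one_le_left (Real.Gamma_pos_of_pos hx0).le hx
  have h2 : Real.Gamma (x + 1) ≤ Real.Gamma (n + 1) :=
    Real.Gamma_strictMonoOn_Ici.monotoneOn (by simp; linarith) (by simp; linarith) (by linarith)
  have h3 : Real.Gamma (n + 1) ≤ (n : ℝ) ^ n := by
    rw [Real.Gamma_nat_eq_factorial]
    exact_mod_cast Nat.factorial_le_pow n
  have h4 : Real.log n ≤ 2 * T ^ (1 / 2 : ℝ) := by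
    have := Real.log_le_rpow_div hn0.le (show (0 : ℝ) < 1 / 2 by norm_num)
    have := Real.rpow_le_rpow hn0.le hnT (show (0 : ℝ) ≤ 1 / 2 by norm_num)
    linarith
  have h5 : T ^ (3 / 2 : ℝ) = T * T ^ (1 / 2 : ℝ) := by
    rw [show (3 / 2 : ℝ) = 1 + 1 / 2 by norm_num, Real.rpow_add hT0, Real.rpow_one]
  have h6 : 0 ≤ 2 * T ^ (1 / 2 : ℝ) := by positivity
  calc Real.Gamma x ≤ (n : ℝ) ^ n := h1.trans (h2.trans h3)
    _ = Real.exp (n * Real.log n) := by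
      rw [mul_comm, Real.exp_mul, Real.exp_log hn0, Real.rpow_natCast]
    _ ≤ _ := by
      rw [Real.exp_le_exp, h5]
      calc n * Real.log n ≤ T * (2 * T ^ (1 / 2 : ℝ)) := by gcongr
        _ = _ := by ring

theorem exists_norm_riemannXi_le : ∃ C : ℝ, 0 < C ∧ ∀ s : ℂ,
    ‖riemannXi (1 / 2 + s)‖ ≤ C * Real.exp (4 * (‖s‖ + 3) ^ (3 / 2 : ℝ)) := by
  set Z : ℝ := ∑' n : ℕ, 1 / (n : ℝ) ^ 2 with hZ
  have hZ0 : 0 ≤ Z := tsum_nonneg fun n => by positivity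
  refine ⟨Z + 2, by positivity, fun s => ?_⟩
  set T := ‖s‖ + 3 with hT
  have hs0 := norm_nonneg s
  have hT3 : 3 ≤ T := by linarith
  set σ : ℝ := ‖s‖ + 5 / 2 with hσ
  have hσ2 : 2 ≤ σ := by linarith
  -- The extra `2` moves the real comparison point to `σ ≥ 2`, where the Dirichlet series is at most
  -- `ζ(2)`.
  have bound := norm_completedRiemannZeta₀_le (r := ‖s‖ + 2) (s := s)
    ((Complex.abs_re_le_norm s).trans (by linarith))
  rw [show (1 / 2 + ((‖s‖ + 2 : ℝ) : ℂ)) = (σ : ℂ) by rw [hσ]; push_cast; ring] at bound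
  have real : (completedRiemannZeta₀ σ).re ≤
      Z * Real.exp (2 * T ^ (3 / 2 : ℝ)) + 1 := by
    have e : completedRiemannZeta₀ σ = completedRiemannZeta σ + 1 / (σ : ℂ) + 1 / (1 - (σ : ℂ)) := by
      rw [completedRiemannZeta_eq]; ring
    have r1 : (1 / (σ : ℂ)).re ≤ 1 := by
      rw [show (1 / (σ : ℂ)) = ((1 / σ : ℝ) : ℂ) by push_cast; rfl, Complex.ofReal_re,
        div_le_one (by linarith)]
      linarith
    have r2 : (1 / (1 - (σ : ℂ))).re ≤ 0 := by
      rw [show (1 / (1 - (σ : ℂ))) = ((1 / (1 - σ) : ℝ) : ℂ) by push_cast; rfl, Complex.ofReal_re]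
      exact div_nonpos_of_nonneg_of_nonpos zero_le_one (by linarith)
    have r3 : (completedRiemannZeta σ).re ≤ Z * Real.exp (2 * T ^ (3 / 2 : ℝ)) := by
      refine (Complex.re_le_norm _).trans ?_
      rw [completedZeta_eq_tsum_of_one_lt_re (by simp; linarith), norm_mul, norm_mul]
      have n1 : ‖(Real.pi : ℂ) ^ (-(σ : ℂ) / 2)‖ ≤ 1 := by
        rw [Complex.norm_cpow_eq_rpow_re_of_pos Real.pi_pos]
        refine Real.rpow_le_one_of_one_le_of_nonpos (by linarith [Real.pi_gt_three]) ?_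
        rw [show (-(σ : ℂ) / 2) = ((-σ / 2 : ℝ) : ℂ) by push_cast; rfl, Complex.ofReal_re]
        linarith
      have n2 : ‖Complex.Gamma ((σ : ℂ) / 2)‖ ≤ Real.exp (2 * T ^ (3 / 2 : ℝ)) := by
        rw [show ((σ : ℂ) / 2) = ((σ / 2 : ℝ) : ℂ) by push_cast; rfl, Complex.Gamma_ofReal,
          Complex.norm_real, Real.norm_of_nonneg (Real.Gamma_pos_of_pos (by linarith)).le]
        exact Real.Gamma_le_exp_rpow (by linarith) (by linarith)
      have n3 : ‖∑' n : ℕ, 1 / (n : ℂ) ^ (σ : ℂ)‖ ≤ Z := by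
        refine tsum_of_norm_bounded (Real.summable_one_div_nat_pow.2 one_lt_two).hasSum fun n => ?_
        rcases Nat.eq_zero_or_pos n with rfl | hn
        · have : (σ : ℂ) ≠ 0 := by
            have : σ ≠ 0 := by linarith
            exact_mod_cast this
          simp [Complex.zero_cpow this]
        · have hn1 : (1 : ℝ) ≤ n := by exact_mod_cast hn
          rw [norm_div, norm_one, Complex.norm_natCast_cpow_of_pos hn, Complex.ofReal_re,
            ← Real.rpow_natCast]
          gcongr
          exact_mod_cast hσ2
      calc _ ≤ 1 * Real.exp (2 * T ^ (3 / 2 : ℝ)) * Z := by gcongr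
        _ = _ := by ring
    rw [e, Complex.add_re, Complex.add_re]
    linarith
  set E := Real.exp (2 * T ^ (3 / 2 : ℝ)) with hE
  have hE1 : 1 ≤ E := Real.one_le_exp (by positivity)
  -- The quadratic factor is absorbed in a second copy of `E`, which turns the exponent `2` into
  -- `4`.
  have hTE : T ^ 2 ≤ E := by
    have h1 : T ≤ T ^ (3 / 2 : ℝ) := by
      simpa using Real.rpow_le_rpow_of_exponent_le (by linarith : 1 ≤ T)
        (show (1 : ℝ) ≤ 3 / 2 by norm_num)
    have h2 : T ≤ Real.exp T := by linarith [Real.add_one_le_exp T]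
    calc T ^ 2 ≤ Real.exp T ^ 2 := by gcongr
      _ = Real.exp (2 * T) := by rw [← Real.exp_nat_mul]; norm_num
      _ ≤ E := Real.exp_le_exp.2 (by linarith)
  have hEE : Real.exp (4 * T ^ (3 / 2 : ℝ)) = E * E := by
    rw [hE, ← Real.exp_add]; congr 1; ring
  have hpoly : ‖(1 / 2 + s) * (1 / 2 + s - 1)‖ ≤ E := by
    refine le_trans ?_ hTE
    rw [norm_mul]
    have a1 : ‖1 / 2 + s‖ ≤ T := (norm_add_le _ _).trans (by norm_num; linarith)
    have a2 : ‖1 / 2 + s - 1‖ ≤ T := by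
      rw [show 1 / 2 + s - 1 = s - 1 / 2 by ring]
      exact (norm_sub_le _ _).trans (by norm_num; linarith)
    calc _ ≤ T * T := by gcongr
      _ = _ := by ring
  have hfin : ‖(1 / 2 + s) * (1 / 2 + s - 1) * completedRiemannZeta₀ (1 / 2 + s)‖ ≤
      E * (2 * (Z * E + 1)) := by
    rw [norm_mul]
    gcongr
    linarith
  rw [riemannXi, norm_div, Complex.norm_ofNat, hEE]
  have := norm_add_le ((1 / 2 + s) * (1 / 2 + s - 1) * completedRiemannZeta₀ (1 / 2 + s)) 1
  rw [norm_one] at this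
  nlinarith

/-! ### Slowly growing even functions without zeros -/

open Metric in
/-- A normalized even zero-free function on a disc which grows slowly is close to `1`. -/
theorem exists_eq_exp_of_even {g : ℂ → ℂ} {R M : ℝ} (hR : 0 < R) (hM : 0 < M)
    (hg : Differentiable ℂ g) (heven : ∀ z, g (-z) = g z) (h0 : g 0 = 1)
    (hne : ∀ z ∈ ball (0 : ℂ) R, g z ≠ 0) (hle : ∀ z ∈ ball (0 : ℂ) R, ‖g z‖ ≤ Real.exp M)
    {z : ℂ} (hz : z ∈ ball (0 : ℂ) (R / 2)) :
    ∃ w : ℂ, g z = Complex.exp w ∧ ‖w‖ ≤ 2 * M * (‖z‖ / (R / 2)) ^ 2 := by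
  have hd : DifferentiableOn ℂ (fun z => deriv g z / g z) (ball 0 R) :=
    hg.deriv.differentiableOn.div hg.differentiableOn hne
  -- A primitive of `g'/g` vanishing at `0` is a logarithm of `g`, since `g exp(-h)` has zero
  -- derivative.
  obtain ⟨h, hh0, hh⟩ := hd.isExactOn_ball.with_val_at 0 0
  have hzero : (0 : ℂ) ∈ ball (0 : ℂ) R := mem_ball_self hR
  have hexp : ∀ z ∈ ball (0 : ℂ) R, g z = Complex.exp (h z) := by
    have key : ∀ z ∈ ball (0 : ℂ) R,
        HasDerivAt (fun z => g z * Complex.exp (-h z)) 0 z := by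
      intro z hz
      have := (hg z).hasDerivAt.mul (hh z hz).neg.cexp
      convert! this using 1
      field_simp [hne z hz]
      ring
    intro z hz
    have := (convex_ball (0 : ℂ) R).is_const_of_fderivWithin_eq_zero (𝕜 := ℂ)
      (f := fun z => g z * Complex.exp (-h z))
      (fun w hw => (key w hw).differentiableAt.differentiableWithinAt) (fun w hw => by
        rw [fderivWithin_of_isOpen isOpen_ball hw]
        ext
        simp [(key w hw).deriv]) hz hzero
    simp only [hh0, h0, neg_zero, Complex.exp_zero, mul_one, Complex.exp_neg] at this
    field_simp at this
    exact this
  have hdiff : DifferentiableOn ℂ h (ball 0 R) :=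
    fun z hz => (hh z hz).differentiableAt.differentiableWithinAt
  have hd0 : deriv g 0 = 0 := by
    have h1 : deriv (fun z => g (-z)) 0 = deriv g 0 := by simp_rw [heven]
    rw [deriv_comp_neg, neg_zero] at h1
    linear_combination -h1 / 2
  have hre : MapsTo h (ball 0 R) {z | z.re ≤ M} := by
    intro z hz
    have := hle z hz
    rw [hexp z hz, Complex.norm_exp, Real.exp_le_exp] at this
    exact this
  have hsub : ball (0 : ℂ) (R / 2) ⊆ ball 0 R := ball_subset_ball (by linarith)
  -- Borel–Carathéodory gives `2M|w| / (R - |w|)`, at most `2M` on the half-radius disc.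
  have hmaps : MapsTo h (ball 0 (R / 2)) (closedBall (h 0) (2 * M)) := by
    intro w hw
    have hw' : ‖w‖ < R / 2 := by simpa using hw
    have := Complex.borelCaratheodory_zero hM hdiff hre hR (hsub hw) hh0
    rw [hh0, mem_closedBall_zero_iff]
    refine this.trans ?_
    rw [div_le_iff₀ (by linarith)]
    gcongr
    linarith
  refine ⟨h z, hexp z (hsub hz), ?_⟩
  -- Evenness makes `h'(0) = 0`; this double zero puts the square into the Schwarz bound.
  have hlo : (h · - h 0) =o[nhds 0] (fun w => ‖w - 0‖ ^ 1) := by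
    have := (hh 0 hzero).isLittleO
    simp only [hd0, zero_div, smul_zero, sub_zero] at this
    simpa using this.norm_right
  have := Complex.dist_le_mul_div_pow_of_mapsTo_ball_of_isLittleO
    (hdiff.mono hsub) hmaps hlo hz
  simpa [hh0] using this

/-! ### Dividing zeros out of an entire function -/

theorem Differentiable.iterate_dslope {f : ℂ → ℂ} (hf : Differentiable ℂ f) (a : ℂ) (n : ℕ) :
    Differentiable ℂ ((Function.swap dslope a)^[n] f) := by
  induction n with
  | zero => exact hf
  | succ n ih =>
    rw [Function.iterate_succ_apply']
    rw [← differentiableOn_univ] at ih ⊢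
    exact (Complex.differentiableOn_dslope Filter.univ_mem).2 ih

/-- Iterating `dslope` removes one factor `z - a` at a time and keeps the quotient entire, unlike
the merely local factorization attached to the analytic order. -/
theorem Differentiable.exists_eq_pow_mul {f : ℂ → ℂ} (hf : Differentiable ℂ f) {a : ℂ}
    (ha : analyticOrderAt f a ≠ ⊤) :
    ∃ g : ℂ → ℂ, Differentiable ℂ g ∧ g a ≠ 0 ∧
      ∀ z, f z = (z - a) ^ analyticOrderNatAt f a * g z := by
  obtain ⟨p, hp⟩ := hf.analyticAt a
  have hp0 : p ≠ 0 := by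
    rintro rfl
    exact ha (analyticOrderAt_eq_top.2 (hp.locally_zero_iff.2 rfl))
  refine ⟨_, hf.iterate_dslope a p.order, hp.iterate_dslope_fslope_ne_zero hp0, ?_⟩
  have key : ∀ z, f z = (z - a) ^ p.order * (Function.swap dslope a)^[p.order] f z :=
    fun z => hp.eq_pow_order_mul_iterate_dslope z
  have : analyticOrderNatAt f a = p.order := by
    have h := (hf.analyticAt a).analyticOrderNatAt_eq_iff ha |>.2
      ⟨_, (hf.iterate_dslope a p.order).analyticAt a, hp.iterate_dslope_fslope_ne_zero hp0,
        Filter.Eventually.of_forall key⟩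
    exact h
  rwa [this]

/-- Finitely many zeros of an entire function can be divided out. -/
theorem Differentiable.exists_eq_prod_pow_mul {f : ℂ → ℂ} (hf : Differentiable ℂ f)
    (hord : ∀ a, analyticOrderAt f a ≠ ⊤) (S : Finset ℂ) :
    ∃ g : ℂ → ℂ, Differentiable ℂ g ∧ (∀ a ∈ S, g a ≠ 0) ∧
      ∀ z, f z = (∏ a ∈ S, (z - a) ^ analyticOrderNatAt f a) * g z := by
  induction S using Finset.induction_on with
  | empty => exact ⟨f, hf, by simp, by simp⟩
  | insert b S hb ih =>
    obtain ⟨g, hg, hgS, hgf⟩ := ih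
    have hP : Differentiable ℂ fun z : ℂ => ∏ a ∈ S, (z - a) ^ analyticOrderNatAt f a := by
      fun_prop
    have hPb : (∏ a ∈ S, (b - a) ^ analyticOrderNatAt f a) ≠ 0 :=
      Finset.prod_ne_zero_iff.2 fun a ha => pow_ne_zero _ (sub_ne_zero.2 fun h => hb (h ▸ ha))
    have hPo : analyticOrderAt (fun z : ℂ => ∏ a ∈ S, (z - a) ^ analyticOrderNatAt f a) b = 0 :=
      (hP.analyticAt b).analyticOrderAt_eq_zero.2 hPb
    have hfg : f = (fun z : ℂ => ∏ a ∈ S, (z - a) ^ analyticOrderNatAt f a) * g := funext hgf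
    -- The factors already removed do not vanish at `b`, so the multiplicity there is unchanged.
    have hog : analyticOrderAt f b = analyticOrderAt g b := by
      conv_lhs => rw [hfg]
      rw [analyticOrderAt_mul (hP.analyticAt b) (hg.analyticAt b), hPo, zero_add]
    obtain ⟨k, hk, hkb, hgk⟩ := hg.exists_eq_pow_mul (a := b) (hog ▸ hord b)
    have hnat : analyticOrderNatAt f b = analyticOrderNatAt g b := by
      rw [analyticOrderNatAt, hog, analyticOrderNatAt]
    refine ⟨k, hk, fun a ha => ?_, fun z => ?_⟩
    · rcases Finset.mem_insert.1 ha with rfl | ha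
      · exact hkb
      · intro h
        exact hgS a ha (by rw [hgk, h, mul_zero])
    · rw [Finset.prod_insert hb, hgf z, hgk z, hnat]
      ring

/-! ### Zeros of `ξ` and partial products over the ordinates -/

theorem analyticOnNhd_riemannXi : AnalyticOnNhd ℂ riemannXi univ :=
  fun z _ => differentiable_riemannXi.analyticAt z

theorem analyticOrderAt_riemannXi_ne_top (a : ℂ) : analyticOrderAt riemannXi a ≠ ⊤ := by
  intro h
  exact riemannXi_half_ne_zero <| analyticOnNhd_riemannXi.eqOn_zero_of_preconnected_of_eventuallyEq_zero
    isPreconnected_univ (mem_univ a) (analyticOrderAt_eq_top.1 h) (mem_univ _)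

theorem finite_setOf_riemannXi_eq_zero (R : ℝ) : {z : ℂ | ‖z‖ ≤ R ∧ riemannXi z = 0}.Finite := by
  by_contra h
  obtain ⟨x, -, hx⟩ := Set.Infinite.exists_accPt_of_subset_isCompact h
    (isCompact_closedBall (0 : ℂ) R) (fun z hz => by simpa using hz.1)
  refine riemannXi_half_ne_zero <|
    analyticOnNhd_riemannXi.eqOn_zero_of_preconnected_of_frequently_eq_zero
    isPreconnected_univ (mem_univ x) ?_ (mem_univ _)
  exact (accPt_iff_frequently_nhdsNE.1 hx).mono fun z hz => hz.2

/-- Equal multiplicities at reflected zeros let the linear factors pair into powers of `s² + τ²`. -/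
theorem analyticOrderNatAt_riemannXi_half_sub (z : ℂ) :
    analyticOrderNatAt riemannXi (1 / 2 - z) = analyticOrderNatAt riemannXi (1 / 2 + z) := by
  have h := analyticOrderAt_comp_of_deriv_ne_zero (f := riemannXi) (g := fun s : ℂ => 1 - s)
    (z₀ := 1 / 2 - z) (by fun_prop) (by simp)
  rw [analyticOrderNatAt, analyticOrderNatAt, ← show 1 - (1 / 2 - z) = 1 / 2 + z by ring, ← h]
  congr 2
  funext s
  exact (riemannXi_one_sub s).symm

/-- The positive ordinates of zeros on the critical line, without multiplicity. -/
abbrev XiLineZero : Type := {τ : ℝ // 0 < τ ∧ riemannXi (1 / 2 + Complex.I * τ) = 0}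

theorem finite_xiLineZero_le (R : ℝ) : {τ : XiLineZero | τ.1 ≤ R}.Finite := by
  refine Set.Finite.of_finite_image (f := fun τ : XiLineZero => (1 / 2 + Complex.I * τ.1 : ℂ))
    ((finite_setOf_riemannXi_eq_zero (1 / 2 + R)).subset ?_) ?_
  · rintro _ ⟨τ, hτ, rfl⟩
    refine ⟨(norm_add_le _ _).trans ?_, τ.2.2⟩
    have hτ' : τ.1 ≤ R := hτ
    simp [abs_of_pos τ.2.1, hτ']
  · intro a _ b _ hab
    simpa [Subtype.ext_iff] using hab

/-- The ordinates up to height `R`. -/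
noncomputable def xiOrdinatesUpTo (R : ℝ) : Finset XiOrdinate :=
  (finite_xiLineZero_le R).toFinset.sigma fun _ => Finset.univ

theorem mem_xiOrdinatesUpTo {R : ℝ} {i : XiOrdinate} : i ∈ xiOrdinatesUpTo R ↔ i.val ≤ R := by
  simp [xiOrdinatesUpTo, XiOrdinate.val]

theorem XiOrdinate.val_pos (i : XiOrdinate) : 0 < i.val := i.1.2.1

instance : Countable XiOrdinate := by
  have h : (univ : Set XiOrdinate) = ⋃ n : ℕ, ↑(xiOrdinatesUpTo n) := by
    ext i
    simpa [mem_xiOrdinatesUpTo] using exists_nat_ge i.val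
  exact countable_univ_iff.1 (h ▸ countable_iUnion fun n => Finset.countable_toSet _)

theorem XiOrdinate.ofReal_val_ne_zero (i : XiOrdinate) : (i.val : ℂ) ≠ 0 :=
  Complex.ofReal_ne_zero.2 i.val_pos.ne'

/-- The partial Hadamard product of `ξ`. -/
noncomputable def xiProd (R : ℝ) (s : ℂ) : ℂ :=
  ∏ i ∈ xiOrdinatesUpTo R, (1 + s ^ 2 / (i.val : ℂ) ^ 2)

theorem differentiable_xiProd (R : ℝ) : Differentiable ℂ (xiProd R) := by
  unfold xiProd
  fun_prop

theorem xiProd_zero (R : ℝ) : xiProd R 0 = 1 := by simp [xiProd]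

theorem xiProd_neg (R : ℝ) (s : ℂ) : xiProd R (-s) = xiProd R s := by simp [xiProd]

/-- On this circle `|s²/τ²| ≥ 4` for every factor. Hence dividing `ξ` by the product does not spoil
the growth bound. -/
theorem one_le_norm_xiProd {R : ℝ} {s : ℂ} (hs : ‖s‖ = 2 * R) : 1 ≤ ‖xiProd R s‖ := by
  rw [xiProd, norm_prod, ← Finset.prod_const_one (s := xiOrdinatesUpTo R)]
  refine Finset.prod_le_prod (fun _ _ => zero_le_one) fun i hi => ?_
  have hi' := mem_xiOrdinatesUpTo.1 hi
  have h2 : 2 ≤ ‖s ^ 2 / (i.val : ℂ) ^ 2‖ := by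
    rw [norm_div, norm_pow, norm_pow, Complex.norm_real, Real.norm_of_nonneg i.val_pos.le, hs,
      le_div_iff₀ (pow_pos i.val_pos 2)]
    nlinarith [i.val_pos]
  have := norm_sub_le_norm_add (s ^ 2 / (i.val : ℂ) ^ 2) 1
  rw [norm_one, add_comm (s ^ 2 / _)] at this
  linarith

/-- Division of `ξ` by its zeros up to height `R`, assuming that they lie on the critical line. -/
theorem exists_riemannXi_eq_xiProd_mul (hRH : ∀ ρ : ℂ, riemannXi ρ = 0 → ρ.re = 1 / 2) (R : ℝ) :
    ∃ g : ℂ → ℂ, Differentiable ℂ g ∧ (∀ z, g (-z) = g z) ∧ g 0 = 1 ∧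
      (∀ z, ‖z‖ ≤ R → g z ≠ 0) ∧
      ∀ s, riemannXi (1 / 2 + s) = riemannXi (1 / 2) * (xiProd R s * g s) := by
  classical
  set T := (finite_xiLineZero_le R).toFinset with hT
  set p : XiLineZero → ℂ := fun τ => 1 / 2 + Complex.I * τ.1 with hp
  set q : XiLineZero → ℂ := fun τ => 1 / 2 - Complex.I * τ.1 with hq
  set m : XiLineZero → ℕ := fun τ => analyticOrderNatAt riemannXi (p τ) with hm
  have hpinj : Function.Injective p := fun a b hab => by
    simpa [hp, Subtype.ext_iff] using hab
  have hqinj : Function.Injective q := fun a b hab => by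
    simpa [hq, Subtype.ext_iff] using hab
  have hdisj : Disjoint (T.image p) (T.image q) := by
    rw [Finset.disjoint_left]
    simp only [Finset.mem_image]
    rintro _ ⟨a, -, rfl⟩ ⟨b, -, hab⟩
    have h1 := congrArg Complex.im hab
    simp [hp, hq] at h1
    linarith [a.2.1, b.2.1]
  obtain ⟨g, hg, hgS, hgf⟩ := differentiable_riemannXi.exists_eq_prod_pow_mul
    analyticOrderAt_riemannXi_ne_top (T.image p ∪ T.image q)
  -- From `(s - iτ)(s + iτ) = τ²(1 + s²/τ²)`: the constant collects the `τ²`.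
  set c : ℂ := ∏ τ ∈ T, ((τ.1 : ℂ) ^ 2) ^ m τ with hc
  have hprod : ∀ s : ℂ, (∏ a ∈ T.image p ∪ T.image q,
      (1 / 2 + s - a) ^ analyticOrderNatAt riemannXi a) = c * xiProd R s := by
    intro s
    rw [Finset.prod_union hdisj, Finset.prod_image hpinj.injOn, Finset.prod_image hqinj.injOn,
      ← Finset.prod_mul_distrib, xiProd, xiOrdinatesUpTo, Finset.prod_sigma, hc,
      ← Finset.prod_mul_distrib]
    refine Finset.prod_congr rfl fun τ _ => ?_
    have hτ : (τ.1 : ℂ) ≠ 0 := Complex.ofReal_ne_zero.2 τ.2.1.ne'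
    rw [hq, analyticOrderNatAt_riemannXi_half_sub]
    simp only [XiOrdinate.val, Finset.prod_const, Finset.card_univ, Fintype.card_fin]
    rw [← mul_pow, ← mul_pow]
    congr 1
    simp only [hp]
    field_simp
    linear_combination -4 * (τ.1 : ℂ) ^ 2 * Complex.I_sq
  have hF : ∀ s, riemannXi (1 / 2 + s) = c * xiProd R s * g (1 / 2 + s) := fun s => by
    rw [hgf, hprod]
  have hF0 : riemannXi (1 / 2) = c * g (1 / 2) := by
    have := hF 0
    rwa [add_zero, xiProd_zero, mul_one] at this
  have hg0 : g (1 / 2) ≠ 0 := fun h => riemannXi_half_ne_zero (by rw [hF0, h, mul_zero])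
  have hc0 : c ≠ 0 := fun h => riemannXi_half_ne_zero (by rw [hF0, h, zero_mul])
  have hcomp : Differentiable ℂ fun s => g (1 / 2 + s) / g (1 / 2) := by fun_prop
  refine ⟨fun s => g (1 / 2 + s) / g (1 / 2), hcomp, ?_, by simp only [add_zero]; exact div_self hg0, ?_, ?_⟩
  · have hcomp' : Differentiable ℂ fun s => g (1 / 2 + -s) / g (1 / 2) := by fun_prop
    -- The product can be cancelled only where it is nonzero, for instance near `0`; the identity
    -- theorem extends the evenness to the whole plane.
    have hev : (fun s => g (1 / 2 + -s) / g (1 / 2)) =ᶠ[nhds 0]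
        fun s => g (1 / 2 + s) / g (1 / 2) := by
      have hne : ∀ᶠ s in nhds (0 : ℂ), xiProd R s ≠ 0 :=
        (differentiable_xiProd R).continuous.continuousAt.eventually_ne (by simp [xiProd_zero])
      filter_upwards [hne] with s hs
      have h1 := hF (-s)
      rw [← sub_eq_add_neg, riemannXi_half_sub, hF s, xiProd_neg] at h1
      rw [← sub_eq_add_neg, mul_left_cancel₀ (mul_ne_zero hc0 hs) h1]
    intro z
    exact congrFun (AnalyticOnNhd.eq_of_eventuallyEq (fun w _ => hcomp'.analyticAt w)
      (fun w _ => hcomp.analyticAt w) hev) z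
  · intro z hz h
    have hgz : g (1 / 2 + z) = 0 := (div_eq_zero_iff.1 h).resolve_right hg0
    refine hgS _ ?_ hgz
    have hz0 : riemannXi (1 / 2 + z) = 0 := by rw [hF, hgz, mul_zero]
    -- RH enters here: a zero with `|z| ≤ R` is imaginary, so it is one of those divided out.
    have hre : z.re = 0 := by
      have := hRH _ hz0
      simpa using this
    have hzI : z = Complex.I * (z.im : ℂ) := by
      apply Complex.ext <;> simp [hre]
    have him : |z.im| ≤ R := (Complex.abs_im_le_norm z).trans hz
    rw [Finset.mem_union, Finset.mem_image, Finset.mem_image]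
    rcases lt_trichotomy z.im 0 with h0 | h0 | h0
    · right
      have hzI' : z = -(Complex.I * ((-z.im : ℝ) : ℂ)) := by
        rw [Complex.ofReal_neg, mul_neg, neg_neg]; exact hzI
      refine ⟨⟨-z.im, by linarith, ?_⟩, ?_, ?_⟩
      · rw [← riemannXi_half_sub, sub_eq_add_neg, ← hzI']
        exact hz0
      · simpa [hT] using (neg_le_abs z.im).trans him
      · simp only [hq]
        rw [sub_eq_add_neg, ← hzI']
    · rw [h0, Complex.ofReal_zero, mul_zero] at hzI
      rw [hzI, add_zero] at hz0
      exact absurd hz0 riemannXi_half_ne_zero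
    · left
      refine ⟨⟨z.im, h0, by rw [← hzI]; exact hz0⟩, ?_, ?_⟩
      · simpa [hT] using (le_abs_self z.im).trans him
      · simp only [hp]
        rw [← hzI]
  · intro s
    rw [hF, hF0]
    field_simp

/-! ### The Hadamard product under RH -/

section

open Metric Filter Topology

theorem tendsto_xiProd (hRH : ∀ ρ : ℂ, riemannXi ρ = 0 → ρ.re = 1 / 2) (s : ℂ) :
    Tendsto (fun R : ℝ => xiProd R s) atTop (𝓝 (riemannXi (1 / 2 + s) / riemannXi (1 / 2))) := by
  obtain ⟨C, hC, hgrowth⟩ := exists_norm_riemannXi_le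
  -- The added `1` keeps `log D` nonnegative.
  set D := C / ‖riemannXi (1 / 2)‖ + 1 with hD
  have hx0 : 0 < ‖riemannXi (1 / 2)‖ := norm_pos_iff.2 riemannXi_half_ne_zero
  have hD1 : 1 ≤ D := by rw [hD]; linarith [div_pos hC hx0]
  set M : ℝ → ℝ := fun R => Real.log D + 4 * (2 * R + 3) ^ (3 / 2 : ℝ) with hM
  have hev : ∀ᶠ R : ℝ in atTop, ∃ w : ℂ,
      riemannXi (1 / 2 + s) / riemannXi (1 / 2) = xiProd R s * Complex.exp w ∧
        ‖w‖ ≤ 2 * M R * (‖s‖ / (R / 2)) ^ 2 := by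
    filter_upwards [eventually_gt_atTop (2 * ‖s‖), eventually_gt_atTop 0] with R hRs hR
    obtain ⟨g, hg, heven, hg0, hne, hgF⟩ := exists_riemannXi_eq_xiProd_mul hRH R
    have hM0 : 0 < M R := by
      have := Real.log_nonneg hD1
      have : 0 < (2 * R + 3) ^ (3 / 2 : ℝ) := Real.rpow_pos_of_pos (by linarith) _
      simp only [hM]
      linarith
    have hbound : ∀ z ∈ ball (0 : ℂ) R, ‖g z‖ ≤ Real.exp (M R) := by
      intro z hz
      -- Maximum principle: the quotient is estimated on `|w| = 2R`, where the product has modulus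
      -- at least `1`.
      refine Complex.norm_le_of_forall_mem_frontier_norm_le (U := ball (0 : ℂ) (2 * R))
        isBounded_ball hg.diffContOnCl ?_ (subset_closure (ball_subset_ball (by linarith) hz))
      intro w hw
      rw [frontier_ball _ (by positivity), mem_sphere_zero_iff_norm] at hw
      have h1 := hgrowth w
      rw [hgF, norm_mul, norm_mul, hw] at h1
      have h2 := one_le_norm_xiProd hw
      have h3 : ‖g w‖ ≤ ‖xiProd R w‖ * ‖g w‖ := le_mul_of_one_le_left (norm_nonneg _) h2
      have h4 : ‖g w‖ ≤ C / ‖riemannXi (1 / 2)‖ * Real.exp (4 * (2 * R + 3) ^ (3 / 2 : ℝ)) := by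
        rw [div_mul_eq_mul_div, le_div_iff₀ hx0, mul_comm ‖g w‖]
        exact (mul_le_mul_of_nonneg_left h3 hx0.le).trans h1
      rw [hM, Real.exp_add, Real.exp_log (by linarith)]
      refine h4.trans ?_
      gcongr
      rw [hD]
      linarith
    obtain ⟨w, hw, hw'⟩ := exists_eq_exp_of_even hR hM0 hg heven hg0
      (fun z hz => hne z (mem_ball_zero_iff.1 hz).le) hbound
      (z := s) (by rw [mem_ball_zero_iff]; linarith)
    refine ⟨w, ?_, hw'⟩
    rw [hgF, ← hw, mul_div_cancel_left₀ _ riemannXi_half_ne_zero]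
  obtain ⟨w, hw⟩ := hev.choice
  have hlim : Tendsto (fun R : ℝ => 2 * M R * (‖s‖ / (R / 2)) ^ 2) atTop (𝓝 0) := by
    have hA : Tendsto (fun R : ℝ => (2 * R + 3) ^ (3 / 2 : ℝ) / R ^ 2) atTop (𝓝 0) := by
      have hup : Tendsto (fun R : ℝ => 3 ^ (3 / 2 : ℝ) * R ^ (-(1 / 2) : ℝ)) atTop (𝓝 0) := by
        simpa using (tendsto_rpow_neg_atTop (show (0 : ℝ) < 1 / 2 by norm_num)).const_mul
          ((3 : ℝ) ^ (3 / 2 : ℝ))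
      refine squeeze_zero' ?_ ?_ hup
      · filter_upwards [eventually_gt_atTop 0] with R hR
        positivity
      · filter_upwards [eventually_ge_atTop 3] with R hR
        have hR0 : 0 < R := by linarith
        rw [div_le_iff₀ (by positivity), mul_assoc, ← Real.rpow_natCast, ← Real.rpow_add hR0,
          show (-(1 / 2) + (2 : ℕ) : ℝ) = 3 / 2 by norm_num, ← Real.mul_rpow (by norm_num) hR0.le]
        gcongr
        linarith
    have hB : Tendsto (fun R : ℝ => Real.log D / R ^ 2) atTop (𝓝 0) :=
      tendsto_const_nhds.div_atTop (tendsto_pow_atTop two_ne_zero)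
    have := (hB.add (hA.const_mul 4)).const_mul (8 * ‖s‖ ^ 2)
    simp only [mul_zero, add_zero] at this
    refine this.congr' ?_
    filter_upwards [eventually_gt_atTop 0] with R hR
    simp only [hM]
    field_simp
    ring
  have hw0 : Tendsto w atTop (𝓝 0) :=
    squeeze_zero_norm' (hw.mono fun R h => h.2) hlim
  have hexp : Tendsto (fun R => riemannXi (1 / 2 + s) / riemannXi (1 / 2) * Complex.exp (-w R)) atTop
      (𝓝 (riemannXi (1 / 2 + s) / riemannXi (1 / 2))) := by
    simpa using (hw0.neg.cexp).const_mul (riemannXi (1 / 2 + s) / riemannXi (1 / 2))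
  refine hexp.congr' ?_
  filter_upwards [hw] with R hR
  rw [hR.1, mul_assoc, ← Complex.exp_add, add_neg_cancel, Complex.exp_zero, mul_one]

theorem tendsto_xiOrdinatesUpTo : Tendsto xiOrdinatesUpTo atTop atTop :=
  tendsto_atTop_finset_of_monotone
    (fun _ _ h _ hi => mem_xiOrdinatesUpTo.2 ((mem_xiOrdinatesUpTo.1 hi).trans h))
    fun i => ⟨i.val, mem_xiOrdinatesUpTo.2 le_rfl⟩

theorem Finset.sum_le_prod_one_add {ι : Type*} (u : Finset ι) {f : ι → ℝ} (hf : ∀ i, 0 ≤ f i) :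
    ∑ i ∈ u, f i ≤ ∏ i ∈ u, (1 + f i) := by
  suffices h : 1 + ∑ i ∈ u, f i ≤ ∏ i ∈ u, (1 + f i) by linarith
  classical
  induction u using Finset.induction_on with
  | empty => simp
  | insert a u ha ih =>
    rw [Finset.sum_insert ha, Finset.prod_insert ha]
    have := Finset.sum_nonneg fun i (_ : i ∈ u) => hf i
    nlinarith [hf a]

/-- At `s = 1` all factors are real and at least `1`, so the convergent products bound the partial
sums of `τ⁻²`. -/
theorem summable_xiOrdinate (hRH : ∀ ρ : ℂ, riemannXi ρ = 0 → ρ.re = 1 / 2) :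
    Summable fun i : XiOrdinate => 1 / i.val ^ 2 := by
  have hpos : ∀ i : XiOrdinate, 0 ≤ 1 / i.val ^ 2 := fun i => by positivity
  set L := ‖riemannXi (1 / 2 + 1) / riemannXi (1 / 2)‖ with hL
  refine summable_of_sum_le (c := L + 1) hpos fun u => ?_
  have h1 := (tendsto_xiProd hRH 1).norm.eventually_le_const (show _ < L + 1 by linarith)
  obtain ⟨R, hR, huR⟩ := (h1.and (tendsto_xiOrdinatesUpTo.eventually_ge_atTop u)).exists
  calc ∑ i ∈ u, 1 / i.val ^ 2 ≤ ∑ i ∈ xiOrdinatesUpTo R, 1 / i.val ^ 2 :=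
        Finset.sum_le_sum_of_subset_of_nonneg huR fun i _ _ => hpos i
    _ ≤ ∏ i ∈ xiOrdinatesUpTo R, (1 + 1 / i.val ^ 2) := Finset.sum_le_prod_one_add _ hpos
    _ = ‖xiProd R 1‖ := by
      rw [xiProd, norm_prod]
      refine Finset.prod_congr rfl fun i _ => ?_
      rw [show (1 + 1 ^ 2 / (i.val : ℂ) ^ 2) = ((1 + 1 / i.val ^ 2 : ℝ) : ℂ) by push_cast; simp,
        Complex.norm_real, Real.norm_of_nonneg (by linarith [hpos i])]
    _ ≤ L + 1 := hR

/-- Summability of `τ⁻²` gives unconditional convergence; the products ordered by height identify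
the limit. -/
theorem hasProd_riemannXi (hRH : ∀ ρ : ℂ, riemannXi ρ = 0 → ρ.re = 1 / 2) (s : ℂ) :
    HasProd (fun i : XiOrdinate => 1 + s ^ 2 / (i.val : ℂ) ^ 2)
      (riemannXi (1 / 2 + s) / riemannXi (1 / 2)) := by
  have hs : Summable fun i : XiOrdinate => ‖s ^ 2 / (i.val : ℂ) ^ 2‖ := by
    refine ((summable_xiOrdinate hRH).mul_left (‖s‖ ^ 2)).congr fun i => ?_
    rw [norm_div, norm_pow, norm_pow, Complex.norm_real, Real.norm_of_nonneg i.val_pos.le]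
    ring
  have hm : Multipliable fun i : XiOrdinate => 1 + s ^ 2 / (i.val : ℂ) ^ 2 :=
    multipliable_one_add_of_summable hs
  have h := hm.hasProd
  have h2 := h.comp tendsto_xiOrdinatesUpTo
  rwa [tendsto_nhds_unique h2 (tendsto_xiProd hRH s)] at h

theorem hasProd_riemannXi_inv (hRH : ∀ ρ : ℂ, riemannXi ρ = 0 → ρ.re = 1 / 2) {s : ℂ}
    (hs : riemannXi (1 / 2 + s) ≠ 0) :
    HasProd (fun i : XiOrdinate => (i.val : ℂ) ^ 2 / ((i.val : ℂ) ^ 2 + s ^ 2))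
      (riemannXi (1 / 2) / riemannXi (1 / 2 + s)) := by
  have h := (hasProd_riemannXi hRH s).inv₀ (div_ne_zero hs riemannXi_half_ne_zero)
  rw [inv_div] at h
  refine h.congr_fun fun i => ?_
  have := i.ofReal_val_ne_zero
  rw [one_add_div (pow_ne_zero 2 this), inv_div]

theorem riemannXi_ne_zero_of_re_sq_nonneg (hRH : ∀ ρ : ℂ, riemannXi ρ = 0 → ρ.re = 1 / 2) {s : ℂ}
    (hs : 0 ≤ (s ^ 2).re) : riemannXi (1 / 2 + s) ≠ 0 := by
  intro h
  have hre : s.re = 0 := by simpa using hRH _ h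
  have him : s.im = 0 := by
    rw [pow_two, Complex.mul_re, hre] at hs
    nlinarith
  have h0 : s = 0 := Complex.ext hre him
  rw [h0, add_zero] at h
  exact riemannXi_half_ne_zero h

end

/-! ### Sums of independent exponential variables -/

section

open Filter Topology

theorem measurable_gammaPDF (a r : ℝ) : Measurable (gammaPDF a r) :=
  (measurable_gammaPDFReal a r).ennreal_ofReal

theorem ae_nonneg_expMeasure (r : ℝ) : ∀ᵐ x ∂expMeasure r, 0 ≤ x := by
  rw [expMeasure, gammaMeasure, ae_withDensity_iff (measurable_gammaPDF 1 r)]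
  refine ae_of_all _ fun x hx => ?_
  by_contra h
  exact hx (gammaPDF_of_neg (not_le.1 h))

/-- `x` times the `Exp(r)` density is `1/r` times the `Gamma(2, r)` density. -/
theorem lintegral_id_expMeasure {r : ℝ} (hr : 0 < r) :
    ∫⁻ x, ENNReal.ofReal x ∂expMeasure r = ENNReal.ofReal (1 / r) := by
  rw [expMeasure, gammaMeasure, lintegral_withDensity_eq_lintegral_mul _
    (measurable_gammaPDF 1 r) ENNReal.measurable_ofReal]
  have h : ∀ x, (gammaPDF 1 r * fun a => ENNReal.ofReal a) x =
      ENNReal.ofReal (1 / r) * gammaPDF 2 r x := by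
    intro x
    rw [Pi.mul_apply]
    rcases lt_or_ge x 0 with hx | hx
    · rw [gammaPDF_of_neg hx, gammaPDF_of_neg hx, zero_mul, mul_zero]
    · rw [gammaPDF_of_nonneg hx, gammaPDF_of_nonneg hx, ← ENNReal.ofReal_mul' hx,
        ← ENNReal.ofReal_mul (by positivity)]
      congr 1
      rw [Real.Gamma_one, Real.Gamma_two, sub_self, Real.rpow_zero, Real.rpow_one,
        show (2 : ℝ) - 1 = 1 by norm_num, Real.rpow_one, Real.rpow_two]
      field_simp
  simp_rw [h]
  rw [lintegral_const_mul _ (measurable_gammaPDF 2 r),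
    lintegral_gammaPDF_eq_one two_pos hr, mul_one]

theorem integral_cexp_expMeasure {r : ℝ} (hr : 0 < r) {w : ℂ} (hw : 0 ≤ w.re) :
    ∫ x, Complex.exp (-w * (x : ℂ)) ∂expMeasure r = r / (r + w) := by
  have hre : (-(r + w) : ℂ).re < 0 := by simp; linarith
  have hne : (r + w : ℂ) ≠ 0 := fun h => by rw [h] at hre; simp at hre
  rw [expMeasure, gammaMeasure, integral_withDensity_eq_integral_toReal_smul
    (measurable_gammaPDF 1 r) (ae_of_all _ fun x => ENNReal.ofReal_lt_top)]
  have h : ∀ x : ℝ, (gammaPDF 1 r x).toReal • Complex.exp (-w * (x : ℂ)) =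
      (Ici (0 : ℝ)).indicator (fun x : ℝ => (r : ℂ) * Complex.exp (-(r + w) * x)) x := by
    intro x
    rcases lt_or_ge x 0 with hx | hx
    · rw [gammaPDF_of_neg hx, indicator_of_notMem (by simpa using hx)]
      simp
    · rw [gammaPDF_of_nonneg hx, indicator_of_mem (by simpa using hx),
        ENNReal.toReal_ofReal (by rw [Real.Gamma_one]; positivity), Complex.real_smul]
      simp only [Real.Gamma_one, sub_self, Real.rpow_zero, Real.rpow_one, div_one, mul_one]
      push_cast
      rw [mul_assoc, ← Complex.exp_add]
      congr 2
      ring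
  simp_rw [h]
  rw [integral_indicator measurableSet_Ici, integral_Ici_eq_integral_Ioi, integral_const_mul,
    integral_exp_mul_complex_Ioi hre]
  simp only [Complex.ofReal_zero, mul_zero, Complex.exp_zero]
  field_simp

theorem exists_isXiExpFamily : ∃ (Ω : Type) (_ : MeasurableSpace Ω) (P : Measure Ω)
    (Y : XiOrdinate → Ω → ℝ), IsXiExpFamily P Y := by
  have : ∀ i : XiOrdinate, IsProbabilityMeasure (expMeasure (i.val ^ 2)) := fun i =>
    isProbabilityMeasure_expMeasure (pow_pos i.val_pos 2)
  obtain ⟨Ω, mΩ, P, Y, -, hlaw, hind, hP⟩ := exists_hasLaw_indepFun (fun _ : XiOrdinate => ℝ)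
    fun i => expMeasure (i.val ^ 2)
  exact ⟨Ω, mΩ, P, Y, hP, hlaw, hind⟩

namespace IsXiExpFamily

variable {Ω : Type*} [MeasurableSpace Ω] {P : Measure Ω} {Y : XiOrdinate → Ω → ℝ}

theorem aemeasurable (hY : IsXiExpFamily P Y) (i : XiOrdinate) : AEMeasurable (Y i) P :=
  (hY.law i).aemeasurable

theorem ae_nonneg (hY : IsXiExpFamily P Y) : ∀ᵐ ω ∂P, ∀ i, 0 ≤ Y i ω := by
  refine ae_all_iff.2 fun i => ?_
  have h := ae_nonneg_expMeasure (i.val ^ 2)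
  rw [← (hY.law i).map_eq] at h
  exact ae_of_ae_map (hY.aemeasurable i) h

/-- By Tonelli the expectation of the sum is `∑ τ⁻² < ∞`. -/
theorem ae_summable (hY : IsXiExpFamily P Y)
    (hs : Summable fun i : XiOrdinate => 1 / i.val ^ 2) :
    ∀ᵐ ω ∂P, Summable fun i => Y i ω := by
  have hfin : ∫⁻ ω, ∑' i, ENNReal.ofReal (Y i ω) ∂P ≠ ⊤ := by
    rw [lintegral_tsum fun i => (hY.aemeasurable i).ennreal_ofReal]
    have h : ∀ i, ∫⁻ ω, ENNReal.ofReal (Y i ω) ∂P = ENNReal.ofReal (1 / i.val ^ 2) := fun i => by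
      rw [(hY.law i).lintegral_comp (f := ENNReal.ofReal) ENNReal.measurable_ofReal.aemeasurable,
        lintegral_id_expMeasure (pow_pos i.val_pos 2)]
    simp_rw [h]
    exact hs.tsum_ofReal_ne_top
  filter_upwards [hY.ae_nonneg, ae_lt_top' (AEMeasurable.tsum fun i =>
    (hY.aemeasurable i).ennreal_ofReal) hfin] with ω h0 hω
  refine (ENNReal.summable_toReal hω.ne).congr fun i => ?_
  exact ENNReal.toReal_ofReal (h0 i)

theorem aemeasurable_tsum (hY : IsXiExpFamily P Y)
    (hs : Summable fun i : XiOrdinate => 1 / i.val ^ 2) :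
    AEMeasurable (fun ω => ∑' i, Y i ω) P := by
  refine aemeasurable_of_tendsto_metrizable_ae (u := atTop)
    (f := fun (u : Finset XiOrdinate) ω => ∑ i ∈ u, Y i ω)
    (fun u => Finset.aemeasurable_fun_sum u fun i _ => hY.aemeasurable i) ?_
  filter_upwards [hY.ae_summable hs] with ω hω
  exact hω.hasSum

/-- Independence factors the finite sums. As `Y ≥ 0` and `Re w ≥ 0`, the integrands are bounded by
`1`, and dominated convergence applies along finite subsets because the index set is countable. -/
theorem hasProd_integral_cexp (hY : IsXiExpFamily P Y)
    (hs : Summable fun i : XiOrdinate => 1 / i.val ^ 2) {w : ℂ} (hw : 0 ≤ w.re) :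
    HasProd (fun i : XiOrdinate => (i.val : ℂ) ^ 2 / ((i.val : ℂ) ^ 2 + w))
      (∫ ω, Complex.exp (-w * ((∑' i, Y i ω : ℝ) : ℂ)) ∂P) := by
  have := hY.prob
  have hcont : Continuous fun x : ℝ => Complex.exp (-w * (x : ℂ)) := by fun_prop
  have hprod : ∀ u : Finset XiOrdinate,
      ∏ i ∈ u, (i.val : ℂ) ^ 2 / ((i.val : ℂ) ^ 2 + w) =
        ∫ ω, Complex.exp (-w * ((∑ i ∈ u, Y i ω : ℝ) : ℂ)) ∂P := by
    intro u
    have hu : iIndepFun (fun i : u => Y i) P := hY.indep.precomp Subtype.val_injective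
    have h := hu.integral_fun_prod_comp (fun i => hY.aemeasurable i)
      (f := fun _ (x : ℝ) => Complex.exp (-w * (x : ℂ))) fun i => hcont.aestronglyMeasurable
    have h1 : ∀ i : XiOrdinate, ∫ ω, Complex.exp (-w * (Y i ω : ℂ)) ∂P =
        (i.val : ℂ) ^ 2 / ((i.val : ℂ) ^ 2 + w) := fun i => by
      have := (hY.law i).integral_comp (f := fun x : ℝ => Complex.exp (-w * (x : ℂ)))
        hcont.aestronglyMeasurable
      rw [integral_cexp_expMeasure (pow_pos i.val_pos 2) hw] at this
      simpa [Function.comp_def] using this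
    simp_rw [h1] at h
    rw [← Finset.prod_coe_sort, ← h]
    refine integral_congr_ae (ae_of_all _ fun ω => ?_)
    simp only
    rw [← Complex.exp_sum, ← Finset.mul_sum, Finset.sum_coe_sort u fun i => (Y i ω : ℂ)]
    push_cast
    rfl
  rw [HasProd]
  simp_rw [hprod]
  refine tendsto_integral_filter_of_dominated_convergence (fun _ => 1) ?_ ?_
    (integrable_const 1) ?_
  · exact Eventually.of_forall fun u => (hcont.measurable.comp_aemeasurable
      (Finset.aemeasurable_fun_sum u fun i _ => hY.aemeasurable i)).aestronglyMeasurable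
  · refine Eventually.of_forall fun u => ?_
    filter_upwards [hY.ae_nonneg] with ω hω
    rw [Complex.norm_exp, Real.exp_le_one_iff, Complex.re_mul_ofReal, Complex.neg_re]
    have := Finset.sum_nonneg fun i (_ : i ∈ u) => hω i
    nlinarith
  · filter_upwards [hY.ae_summable hs] with ω hω
    exact (hcont.tendsto _).comp hω.hasSum

end IsXiExpFamily

end

/-! ### The Thorin measure of `H` -/

section

open Filter Topology

theorem xiThorinMeasure_eq :
    xiThorinMeasure = Measure.sum fun i : XiOrdinate => (1 : ENNReal) • Measure.dirac (i.val ^ 2) := by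
  simp [xiThorinMeasure]

theorem xiThorinMeasure_Iic_zero : xiThorinMeasure (Iic 0) = 0 := by
  rw [xiThorinMeasure, Measure.sum_apply _ measurableSet_Iic, ENNReal.tsum_eq_zero]
  intro i
  rw [Measure.dirac_apply' _ measurableSet_Iic, indicator_of_notMem]
  simpa using i.val_pos.ne'

theorem xiThorinMeasure_restrict : xiThorinMeasure.restrict (Ioi 0) = xiThorinMeasure := by
  refine Measure.restrict_eq_self_of_ae_mem ?_
  rw [ae_iff]
  convert! xiThorinMeasure_Iic_zero using 2
  ext z
  simp

theorem integrable_xiThorinMeasure {f : ℝ → ℝ}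
    (hf : Summable fun i : XiOrdinate => ‖f (i.val ^ 2)‖) : Integrable f xiThorinMeasure := by
  rw [xiThorinMeasure_eq]
  exact integrable_sum_dirac (by simp) (by simpa using hf)

theorem isThorinMeasure_xiThorinMeasure
    (hs : Summable fun i : XiOrdinate => 1 / i.val ^ 2) : IsThorinMeasure xiThorinMeasure where
  carried := xiThorinMeasure_Iic_zero
  finite_compact := by
    intro K hK _
    obtain ⟨N, hN⟩ := hK.bddAbove
    have hsub : K ⊆ Iic N := fun z hz => hN hz
    refine (measure_mono hsub).trans_lt ?_
    rw [xiThorinMeasure, Measure.sum_apply _ measurableSet_Iic,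
      -- With `τ > N + 1` instead of `τ > N`, `τ² > N` holds also when `N < 1`.
      tsum_eq_sum (s := xiOrdinatesUpTo (N + 1))]
    · exact ENNReal.sum_lt_top.2 fun i _ => measure_lt_top _ _
    · intro i hi
      rw [mem_xiOrdinatesUpTo, not_le] at hi
      rw [Measure.dirac_apply' _ measurableSet_Iic, indicator_of_notMem]
      rw [mem_Iic, not_le]
      rcases lt_or_ge N 0 with h | h
      · exact h.trans (pow_pos i.val_pos 2)
      · nlinarith
  integrable_log := by
    rw [← integrable_indicator_iff measurableSet_Ioo]
    refine integrable_xiThorinMeasure (summable_of_ne_finset_zero (s := xiOrdinatesUpTo 1) ?_)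
    intro i hi
    rw [mem_xiOrdinatesUpTo, not_le] at hi
    rw [indicator_of_notMem, norm_zero]
    intro h
    nlinarith [h.2]
  integrable_inv := by
    rw [← integrable_indicator_iff measurableSet_Ioi]
    refine integrable_xiThorinMeasure (hs.of_nonneg_of_le (fun i => norm_nonneg _) fun i => ?_)
    refine (norm_indicator_le_norm_self _ _).trans ?_
    rw [norm_inv, one_div, Real.norm_of_nonneg (pow_pos i.val_pos 2).le]

theorem IsXiExpFamily.isGGCWith {Ω : Type*} [MeasurableSpace Ω] {P : Measure Ω}
    {Y : XiOrdinate → Ω → ℝ} (hY : IsXiExpFamily P Y)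
    (hs : Summable fun i : XiOrdinate => 1 / i.val ^ 2) :
    IsGGCWith (P.map fun ω => ∑' i, Y i ω) 0 xiThorinMeasure where
  prob := by
    have := hY.prob
    exact Measure.isProbabilityMeasure_map (hY.aemeasurable_tsum hs)
  carried := by
    rw [Measure.map_apply_of_aemeasurable (hY.aemeasurable_tsum hs) measurableSet_Iio]
    refine measure_mono_null (t := {ω | ¬ ∀ i, 0 ≤ Y i ω}) ?_ hY.ae_nonneg
    intro ω hω h
    -- No summability is needed: a divergent `tsum` is `0`.
    exact absurd (tsum_nonneg h) (not_le.2 hω)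
  left_nonneg := le_rfl
  thorin := isThorinMeasure_xiThorinMeasure hs
  laplace := by
    intro s hs0
    have hpos : ∀ i : XiOrdinate, 0 < i.val ^ 2 / (i.val ^ 2 + s) := fun i => by
      have := i.val_pos
      positivity
    have hlog : Summable fun i : XiOrdinate => ‖Real.log (i.val ^ 2 / (i.val ^ 2 + s))‖ := by
      refine (hs.mul_left s).of_nonneg_of_le (fun i => norm_nonneg _) fun i => ?_
      have hi := pow_pos i.val_pos 2
      rw [← inv_div, Real.log_inv, norm_neg, Real.norm_of_nonneg (Real.log_nonneg (by
        rw [one_le_div hi]; linarith))]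
      refine (Real.log_le_sub_one_of_pos (by positivity)).trans (le_of_eq ?_)
      have := i.val_pos.ne'
      field_simp
      ring
    -- The same product is evaluated twice: by summing logarithms and as a Laplace transform.
    have h1 := (Real.hasProd_of_hasSum_log hpos hlog.of_norm.hasSum).map Complex.ofRealHom
      Complex.continuous_ofReal
    have h2 := hY.hasProd_integral_cexp hs (w := s) (by simpa using hs0.le)
    have h3 := h1.unique (h2.congr_fun fun i => by simp)
    rw [integral_map (hY.aemeasurable_tsum hs) (by fun_prop), xiThorinMeasure_restrict, neg_zero,
      zero_mul, zero_add, xiThorinMeasure_eq,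
      integral_sum_dirac_eq_tsum (by simp) (by simpa using hlog)]
    simp only [ENNReal.toReal_one, one_smul]
    rw [← Complex.ofReal_inj, ← integral_complex_ofReal]
    refine Eq.trans ?_ h3.symm
    push_cast
    rfl

end

/-! ### Holomorphic extension of the Laplace exponent and the converse -/

section

open Filter Topology

/-- The constant is `κ = cos(arg w / 2)`, attained at `z = |w|`: the difference of squares is `(|w|
- Re w)(z - |w|)² / (2|w|)`. -/
theorem Complex.exists_pos_mul_add_norm_le {w : ℂ} (hw : w ∈ Complex.slitPlane) :
    ∃ κ : ℝ, 0 < κ ∧ ∀ z : ℝ, 0 ≤ z → κ * (z + ‖w‖) ≤ ‖(z : ℂ) + w‖ := by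
  have hr : 0 < ‖w‖ := norm_pos_iff.2 (Complex.slitPlane_ne_zero hw)
  have hx1 : w.re ≤ ‖w‖ := Complex.re_le_norm w
  have hsq : ‖w‖ ^ 2 = w.re ^ 2 + w.im ^ 2 := by
    rw [← Complex.normSq_eq_norm_sq, Complex.normSq_apply]; ring
  have hx2 : 0 < ‖w‖ + w.re := by
    rcases Complex.mem_slitPlane_iff.1 hw with h | h
    · linarith
    · have := pow_pos (abs_pos.2 h) 2
      rw [sq_abs] at this
      nlinarith
  have hk : 0 < (‖w‖ + w.re) / (2 * ‖w‖) := by positivity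
  refine ⟨√((‖w‖ + w.re) / (2 * ‖w‖)), Real.sqrt_pos.2 hk, fun z hz => ?_⟩
  refine le_of_sq_le_sq ?_ (norm_nonneg _)
  have hzw : ‖(z : ℂ) + w‖ ^ 2 = z ^ 2 + 2 * z * w.re + ‖w‖ ^ 2 := by
    rw [hsq, ← Complex.normSq_eq_norm_sq, Complex.normSq_apply]
    simp
    ring
  rw [mul_pow, Real.sq_sqrt hk.le, hzw, div_mul_eq_mul_div, div_le_iff₀ (by positivity)]
  nlinarith [mul_nonneg (sub_nonneg.2 hx1) (sq_nonneg (z - ‖w‖))]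

theorem Complex.norm_log_le (x : ℂ) : ‖Complex.log x‖ ≤ |Real.log ‖x‖| + Real.pi := by
  refine (Complex.norm_le_abs_re_add_abs_im _).trans ?_
  rw [Complex.log_re, Complex.log_im]
  gcongr
  exact Complex.abs_arg_le_pi x

theorem Complex.one_add_div_ofReal_mem_slitPlane {w : ℂ} (hw : w ∈ Complex.slitPlane) {z : ℝ}
    (hz : 0 < z) : 1 + w / z ∈ Complex.slitPlane := by
  rw [Complex.mem_slitPlane_iff] at hw ⊢
  rw [Complex.add_re, Complex.add_im, Complex.div_ofReal_re, Complex.div_ofReal_im]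
  rcases hw with h | h
  · left
    have := div_pos h hz
    simp
    linarith
  · right
    simpa using ⟨h, hz.ne'⟩

namespace IsThorinMeasure

variable {U : Measure ℝ}

/-- Near `0` this is Chebyshev's inequality: `|log z| ≥ log 2` on `(0, 1/2]`. -/
theorem measure_Ioc_lt_top (hU : IsThorinMeasure U) (N : ℝ) : U (Ioc 0 N) < ⊤ := by
  have h1 : U (Ioc 0 (1 / 2)) < ⊤ := by
    have h := hU.integrable_log.measure_norm_ge_lt_top (ε := Real.log 2) (Real.log_pos one_lt_two)
    refine lt_of_le_of_lt ?_ h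
    rw [Measure.restrict_apply' measurableSet_Ioo]
    refine measure_mono fun z hz => ⟨?_, hz.1, hz.2.trans_lt (by norm_num)⟩
    have : Real.log z ≤ Real.log (1 / 2) := Real.log_le_log hz.1 hz.2
    rw [one_div, Real.log_inv] at this
    have h2 := neg_le_abs (Real.log z)
    simp only [mem_ofPred_eq, Real.norm_eq_abs]
    linarith
  have h2 := hU.finite_compact (Icc (1 / 2) N) isCompact_Icc fun z hz =>
    lt_of_lt_of_le (by norm_num) hz.1
  refine (measure_mono (t := Ioc 0 (1 / 2) ∪ Icc (1 / 2) N) fun z hz => ?_).trans_lt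
    (measure_union_lt_top h1 h2)
  rcases le_total z (1 / 2) with h | h
  · exact Or.inl ⟨hz.1, h⟩
  · exact Or.inr ⟨h, hz.2⟩

theorem integrableOn_log_Ioc (hU : IsThorinMeasure U) (N : ℝ) :
    IntegrableOn Real.log (Ioc 0 N) U := by
  have h2 : IntegrableOn Real.log (Icc 1 N) U := by
    refine Measure.integrableOn_of_bounded (M := Real.log N)
      (hU.finite_compact _ isCompact_Icc fun z hz => lt_of_lt_of_le one_pos hz.1).ne
      Real.measurable_log.aestronglyMeasurable ?_
    refine (ae_restrict_iff' measurableSet_Icc).2 (ae_of_all _ fun z hz => ?_)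
    rw [Real.norm_of_nonneg (Real.log_nonneg hz.1)]
    exact Real.log_le_log (lt_of_lt_of_le one_pos hz.1) hz.2
  refine (hU.integrable_log.union h2).mono_set fun z hz => ?_
  rcases lt_or_ge z 1 with h | h
  · exact Or.inl ⟨hz.1, h⟩
  · exact Or.inr ⟨h, hz.2⟩

theorem integrableOn_inv_Ioi (hU : IsThorinMeasure U) {N : ℝ} (hN : 1 ≤ N) :
    IntegrableOn (fun z : ℝ => z⁻¹) (Ioi N) U :=
  hU.integrable_inv.mono_set (Ioi_subset_Ioi hN)

theorem integrableOn_of_bounds (hU : IsThorinMeasure U) {E : Type*} [NormedAddCommGroup E]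
    {f : ℝ → E} (hf : AEStronglyMeasurable f (U.restrict (Ioi 0))) {A B C N : ℝ} (hN : 1 ≤ N)
    (h0 : ∀ z ∈ Ioc 0 N, ‖f z‖ ≤ A * ‖Real.log z‖ + B) (h1 : ∀ z ∈ Ioi N, ‖f z‖ ≤ C * z⁻¹) :
    IntegrableOn f (Ioi 0) U := by
  have hN0 : 0 < N := by linarith
  rw [← Ioc_union_Ioi_eq_Ioi hN0.le]
  refine IntegrableOn.union ?_ ?_
  · refine Integrable.mono' (((hU.integrableOn_log_Ioc N).norm.const_mul A).add
      (integrableOn_const (C := B) (hU.measure_Ioc_lt_top N).ne))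
      (hf.mono_set Ioc_subset_Ioi_self) ?_
    exact (ae_restrict_iff' measurableSet_Ioc).2 (ae_of_all _ h0)
  · refine Integrable.mono' ((hU.integrableOn_inv_Ioi hN).const_mul C)
      (hf.mono_set (Ioi_subset_Ioi hN0.le)) ?_
    exact (ae_restrict_iff' measurableSet_Ioi).2 (ae_of_all _ h1)

theorem integrableOn_log_one_add (hU : IsThorinMeasure U) {w : ℂ} (hw : w ∈ Complex.slitPlane) :
    IntegrableOn (fun z : ℝ => Complex.log (1 + w / z)) (Ioi 0) U := by
  obtain ⟨κ, hκ, hle⟩ := Complex.exists_pos_mul_add_norm_le hw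
  have hr : 0 < ‖w‖ := norm_pos_iff.2 (Complex.slitPlane_ne_zero hw)
  have hmeas : Measurable fun z : ℝ => Complex.log (1 + w / z) := by fun_prop
  -- Beyond `N`, `|w/z| ≤ 1/2` and the logarithm is at most `3/2 |w/z|`. Below `N`, `log |1 + w/z|`
  -- is `log |z + w|`, which is bounded, minus `log z`.
  set N := max 1 (2 * ‖w‖) with hN
  refine hU.integrableOn_of_bounds hmeas.aestronglyMeasurable (N := N) (A := 1)
    (B := |Real.log (κ * ‖w‖)| + |Real.log (N + ‖w‖)| + Real.pi) (C := 3 / 2 * ‖w‖)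
    (le_max_left _ _) ?_ ?_
  · intro z hz
    have hz0 : (z : ℂ) ≠ 0 := Complex.ofReal_ne_zero.2 hz.1.ne'
    refine (Complex.norm_log_le _).trans ?_
    have hlow : κ * ‖w‖ ≤ ‖(z : ℂ) + w‖ := by
      refine le_trans ?_ (hle z hz.1.le)
      gcongr
      linarith [hz.1]
    have hpos : 0 < ‖(z : ℂ) + w‖ := lt_of_lt_of_le (by positivity) hlow
    have hup : ‖(z : ℂ) + w‖ ≤ N + ‖w‖ := by
      refine (norm_add_le _ _).trans ?_
      rw [Complex.norm_real, Real.norm_of_nonneg hz.1.le]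
      linarith [hz.2]
    have e : ‖1 + w / (z : ℂ)‖ = ‖(z : ℂ) + w‖ / z := by
      rw [one_add_div hz0, norm_div, Complex.norm_real, Real.norm_of_nonneg hz.1.le]
    rw [e, Real.log_div hpos.ne' hz.1.ne', one_mul, Real.norm_eq_abs]
    have l1 := Real.log_le_log (by positivity) hlow
    have l2 := Real.log_le_log hpos hup
    have l3 : |Real.log ‖(z : ℂ) + w‖| ≤ |Real.log (κ * ‖w‖)| + |Real.log (N + ‖w‖)| := by
      rw [abs_le]
      constructor
      · linarith [neg_abs_le (Real.log (κ * ‖w‖)), abs_nonneg (Real.log (N + ‖w‖))]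
      · linarith [le_abs_self (Real.log (N + ‖w‖)), abs_nonneg (Real.log (κ * ‖w‖))]
    linarith [abs_sub (Real.log ‖(z : ℂ) + w‖) (Real.log z)]
  · intro z hz
    have hz' : N < z := hz
    have hz0 : 0 < z := lt_of_lt_of_le one_pos ((le_max_left _ _).trans hz'.le)
    have h2 : 2 * ‖w‖ ≤ z := (le_max_right _ _).trans hz'.le
    have e : ‖w / (z : ℂ)‖ = ‖w‖ * z⁻¹ := by
      rw [norm_div, Complex.norm_real, Real.norm_of_nonneg hz0.le, div_eq_mul_inv]
    rw [mul_assoc, ← e]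
    refine Complex.norm_log_one_add_half_le_self ?_
    rw [e, ← div_eq_mul_inv, div_le_iff₀ hz0]
    linarith

/-- The exponent of the Laplace transform of a generalized gamma convolution is holomorphic on the
slit plane. -/
theorem differentiableAt_integral_log (hU : IsThorinMeasure U) {w₀ : ℂ}
    (hw₀ : w₀ ∈ Complex.slitPlane) :
    DifferentiableAt ℂ (fun w : ℂ => ∫ z in Ioi (0 : ℝ), Complex.log (1 + w / z) ∂U) w₀ := by
  obtain ⟨κ, hκ, hle⟩ := Complex.exists_pos_mul_add_norm_le hw₀
  have hr : 0 < ‖w₀‖ := norm_pos_iff.2 (Complex.slitPlane_ne_zero hw₀)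
  have hmeas : ∀ w : ℂ, Measurable fun z : ℝ => Complex.log (1 + w / z) := fun w => by fun_prop
  have hmeas' : Measurable fun z : ℝ => (1 / (z : ℂ)) / (1 + w₀ / z) := by fun_prop
  -- This radius costs half of the term `κ|w₀|`, leaving `|z + w| ≥ κ(z + |w₀|/2)` to dominate the
  -- derivative `1/(z + w)`.
  have hs : Metric.ball w₀ (κ * ‖w₀‖ / 2) ∩ Complex.slitPlane ∈ 𝓝 w₀ :=
    inter_mem (Metric.ball_mem_nhds _ (by positivity)) (Complex.isOpen_slitPlane.mem_nhds hw₀)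
  have hbound : IntegrableOn (fun z : ℝ => (κ * (z + ‖w₀‖ / 2))⁻¹) (Ioi 0) U := by
    have hm : Measurable fun z : ℝ => (κ * (z + ‖w₀‖ / 2))⁻¹ := by fun_prop
    refine hU.integrableOn_of_bounds hm.aestronglyMeasurable (N := 1) (A := 0)
      (B := (κ * (‖w₀‖ / 2))⁻¹) (C := κ⁻¹) le_rfl ?_ ?_
    · intro z hz
      have hz0 := hz.1
      rw [Real.norm_of_nonneg (by positivity), zero_mul, zero_add]
      gcongr
      linarith
    · intro z hz
      have hz0 : 0 < z := one_pos.trans hz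
      rw [Real.norm_of_nonneg (by positivity), ← mul_inv]
      gcongr
      linarith
  refine (hasDerivAt_integral_of_dominated_loc_of_deriv_le
    (F' := fun w z => (1 / (z : ℂ)) / (1 + w / z)) hs
    (Eventually.of_forall fun w => (hmeas w).aestronglyMeasurable)
    (hU.integrableOn_log_one_add hw₀) hmeas'.aestronglyMeasurable
    ?_ hbound ?_).2.differentiableAt
  · refine (ae_restrict_iff' measurableSet_Ioi).2 (ae_of_all _ fun z hz w hw => ?_)
    have hz0 : (0 : ℝ) < z := hz
    have hzc : (z : ℂ) ≠ 0 := Complex.ofReal_ne_zero.2 hz0.ne'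
    have h1 : ‖w - w₀‖ < κ * ‖w₀‖ / 2 := by simpa [dist_eq_norm] using hw.1
    have h2 := hle z hz0.le
    have h3 : ‖(z : ℂ) + w₀‖ ≤ ‖(z : ℂ) + w‖ + ‖w - w₀‖ := by
      have := norm_sub_le ((z : ℂ) + w) (w - w₀)
      rwa [show (z : ℂ) + w - (w - w₀) = z + w₀ by ring] at this
    rw [one_add_div hzc, div_div_div_cancel_right₀ hzc, norm_div, norm_one, one_div]
    gcongr
    linarith
  · refine (ae_restrict_iff' measurableSet_Ioi).2 (ae_of_all _ fun z hz w hw => ?_)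
    exact (((hasDerivAt_id w).div_const (z : ℂ)).const_add 1).clog
      (Complex.one_add_div_ofReal_mem_slitPlane hw.2 hz)

end IsThorinMeasure

theorem Complex.sq_mem_slitPlane_of_re_pos {s : ℂ} (hs : 0 < s.re) :
    s ^ 2 ∈ Complex.slitPlane := by
  rw [Complex.mem_slitPlane_iff, pow_two, Complex.mul_re, Complex.mul_im]
  by_cases h : s.im = 0
  · left
    rw [h]
    nlinarith
  · right
    rw [mul_comm s.im, ← two_mul]
    exact mul_ne_zero two_ne_zero (mul_ne_zero hs.ne' h)

theorem XiThorinCondition.re_eq_half (h : XiThorinCondition) {ρ : ℂ} (hρ : riemannXi ρ = 0) :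
    ρ.re = 1 / 2 := by
  obtain ⟨μ, ⟨a, U, hμ⟩, hlap⟩ := h
  have hU := hμ.thorin
  set Ψ : ℂ → ℂ := fun w => ∫ z in Ioi (0 : ℝ), Complex.log (1 + w / z) ∂U with hΨ
  -- Written as a product, `G` is holomorphic on `Re s > 0` even before `ξ` is known to be zero-free
  -- there.
  set G : ℂ → ℂ := fun s => riemannXi (1 / 2 + s) * Complex.exp (-(a * s ^ 2) - Ψ (s ^ 2)) with hG
  have hD : IsOpen {s : ℂ | 0 < s.re} := isOpen_lt continuous_const Complex.continuous_re
  have hGd : DifferentiableOn ℂ G {s : ℂ | 0 < s.re} := by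
    intro s hs
    have h1 : DifferentiableAt ℂ (fun s : ℂ => Ψ (s ^ 2)) s :=
      (hU.differentiableAt_integral_log (Complex.sq_mem_slitPlane_of_re_pos hs)).comp s
        (f := fun s : ℂ => s ^ 2) (by fun_prop)
    have h2 : DifferentiableAt ℂ (fun s : ℂ => riemannXi (1 / 2 + s)) s :=
      (differentiable_riemannXi _).comp s (f := fun s : ℂ => 1 / 2 + s) (by fun_prop)
    have h3 : DifferentiableAt ℂ (fun s : ℂ => -(a * s ^ 2)) s := by fun_prop
    exact (h2.mul (h3.sub h1).cexp).differentiableWithinAt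
  have hreal : ∀ t : ℝ, 0 < t → G t = riemannXi (1 / 2) := by
    intro t ht
    have hl := hlap (t ^ 2) (by positivity)
    rw [hμ.laplace _ (by positivity), Real.sqrt_sq ht.le] at hl
    have hint : ((∫ z in Ioi (0 : ℝ), Real.log (z / (z + t ^ 2)) ∂U : ℝ) : ℂ) = -Ψ (t ^ 2) := by
      rw [← integral_complex_ofReal, hΨ, ← integral_neg]
      refine setIntegral_congr_fun measurableSet_Ioi fun z hz => ?_
      have hz0 : (0 : ℝ) < z := hz
      have e : (1 + (t : ℂ) ^ 2 / z) = ((1 + t ^ 2 / z : ℝ) : ℂ) := by push_cast; rfl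
      rw [e, ← Complex.ofReal_log (by positivity), ← Complex.ofReal_neg, ← Real.log_inv]
      congr 2
      field_simp
    have hexp : riemannXi (1 / 2) / riemannXi (1 / 2 + t) =
        Complex.exp (-(a * (t : ℂ) ^ 2) - Ψ ((t : ℂ) ^ 2)) := by
      rw [hl]
      push_cast
      rw [hint]
      congr 1
      ring
    -- At a zero the quotient would take the value `0` by convention, but an exponential never
    -- vanishes.
    have hne : riemannXi (1 / 2 + t) ≠ 0 := by
      intro h0
      rw [h0, div_zero] at hexp
      exact Complex.exp_ne_zero _ hexp.symm
    rw [hG]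
    simp only
    rw [← hexp, mul_div_cancel₀ _ hne]
  have hfreq : ∃ᶠ s in 𝓝[≠] (1 : ℂ), G s = riemannXi (1 / 2) := by
    have htend : Tendsto (fun t : ℝ => (t : ℂ)) (𝓝[≠] 1) (𝓝[≠] (1 : ℂ)) := by
      refine tendsto_nhdsWithin_of_tendsto_nhds_of_eventually_within _ ?_ ?_
      · simpa using (Complex.continuous_ofReal.tendsto 1).mono_left nhdsWithin_le_nhds
      · filter_upwards [self_mem_nhdsWithin] with t ht
        simpa using ht
    refine htend.frequently (Eventually.frequently ?_)
    filter_upwards [nhdsWithin_le_nhds (lt_mem_nhds (zero_lt_one' ℝ))] with t ht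
    exact hreal t ht
  have heq : EqOn G (fun _ => riemannXi (1 / 2)) {s : ℂ | 0 < s.re} :=
    (hGd.analyticOnNhd hD).eqOn_of_preconnected_of_frequently_eq
      (fun s _ => analyticAt_const) (convex_halfSpace_re_gt 0).isPreconnected (by simp) hfreq
  have hne : ∀ s : ℂ, 0 < s.re → riemannXi (1 / 2 + s) ≠ 0 := by
    intro s hs h0
    have := heq hs
    simp only [hG, h0, zero_mul] at this
    exact riemannXi_half_ne_zero this.symm
  by_contra hre
  rcases lt_or_gt_of_ne hre with h | h
  · refine hne (1 / 2 - ρ) (by simp; norm_num at h; linarith) ?_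
    rw [← riemannXi_half_sub, sub_sub_cancel, hρ]
  · refine hne (ρ - 1 / 2) (by simp; norm_num at h; linarith) ?_
    rw [add_sub_cancel, hρ]

end

/-! ### The equivalence with Thorin's condition -/

theorem IsXiExpFamily.riemannXi_div_eq_integral {Ω : Type*} [MeasurableSpace Ω] {P : Measure Ω}
    {Y : XiOrdinate → Ω → ℝ} (hY : IsXiExpFamily P Y)
    (hRH : ∀ ρ : ℂ, riemannXi ρ = 0 → ρ.re = 1 / 2) {s : ℂ} (hs : 0 ≤ (s ^ 2).re) :
    riemannXi (1 / 2) / riemannXi (1 / 2 + s) =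
      ∫ ω, Complex.exp (-s ^ 2 * ((∑' i, Y i ω : ℝ) : ℂ)) ∂P :=
  (hasProd_riemannXi_inv hRH (riemannXi_ne_zero_of_re_sq_nonneg hRH hs)).unique
    (hY.hasProd_integral_cexp (summable_xiOrdinate hRH) hs)

theorem xiThorinCondition_of_riemannXi (hRH : ∀ ρ : ℂ, riemannXi ρ = 0 → ρ.re = 1 / 2) :
    XiThorinCondition := by
  obtain ⟨Ω, mΩ, P, Y, hY⟩ := exists_isXiExpFamily
  have hs := summable_xiOrdinate hRH
  refine ⟨_, ⟨0, _, hY.isGGCWith hs⟩, fun s hs0 => ?_⟩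
  have h2 : ((√s : ℝ) : ℂ) ^ 2 = (s : ℂ) := by
    rw [← Complex.ofReal_pow, Real.sq_sqrt hs0.le]
  rw [hY.riemannXi_div_eq_integral hRH (by rw [h2]; simpa using hs0.le), h2,
    integral_map (hY.aemeasurable_tsum hs) (by fun_prop), ← integral_complex_ofReal]
  push_cast
  rfl

theorem mainTheorem4 :
    (RiemannHypothesis →
      (Summable (fun i : XiOrdinate => 1 / i.val ^ 2) ∧
        ∀ s : ℂ, riemannXi (1 / 2 + s) ≠ 0 →
          HasProd (fun i : XiOrdinate => (i.val : ℂ) ^ 2 / ((i.val : ℂ) ^ 2 + s ^ 2))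
            (riemannXi (1 / 2) / riemannXi (1 / 2 + s))) ∧
      (∃ (Ω : Type) (_ : MeasurableSpace Ω) (P : Measure Ω) (Y : XiOrdinate → Ω → ℝ),
        IsXiExpFamily P Y) ∧
      (∀ (Ω : Type*) [MeasurableSpace Ω] (P : Measure Ω) (Y : XiOrdinate → Ω → ℝ),
        IsXiExpFamily P Y →
          (∀ᵐ ω ∂P, Summable fun i => Y i ω) ∧
          AEMeasurable (fun ω => ∑' i, Y i ω) P ∧
          IsGGCWith (P.map fun ω => ∑' i, Y i ω) 0 xiThorinMeasure ∧
          ∀ s : ℂ, 0 ≤ (s ^ 2).re →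
            riemannXi (1 / 2) / riemannXi (1 / 2 + s) =
              ∫ ω, Complex.exp (-s ^ 2 * ((∑' i, Y i ω : ℝ) : ℂ)) ∂P)) ∧
    (XiThorinCondition → ∀ ρ : ℂ, riemannXi ρ = 0 → ρ.re = 1 / 2) ∧
    (RiemannHypothesis ↔ XiThorinCondition) := by
  refine ⟨fun hRH => ?_, fun h ρ hρ => h.re_eq_half hρ,
    fun hRH => xiThorinCondition_of_riemannXi (riemannHypothesis_iff_riemannXi.1 hRH),
    fun h => riemannHypothesis_iff_riemannXi.2 fun ρ hρ => h.re_eq_half hρ⟩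
  have hξ := riemannHypothesis_iff_riemannXi.1 hRH
  have hs := summable_xiOrdinate hξ
  refine ⟨⟨hs, fun s => hasProd_riemannXi_inv hξ⟩, exists_isXiExpFamily, ?_⟩
  intro Ω _ P Y hY
  exact ⟨hY.ae_summable hs, hY.aemeasurable_tsum hs, hY.isGGCWith hs,
    fun s hs' => hY.riemannXi_div_eq_integral hξ hs'⟩
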